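/- For integers $\lambda_1\ge\dots\ge\lambda_n$ let $V_n(\lambda)=V_n(\lambda_1,\dots,\lambda_n)$ be the irreducible complex representation of $\mathrm U(n)$ with highest weight $\lambda$ with respect to the diagonal torus and the positive roots $e_r-e_s$ $(r<s)$, realised as follows: if $\Delta_r(x)$ denotes the leading principal $r\times r$ minor of $x$, then $V_n(\lambda)$ is the span of the translates $x\mapsto f_\lambda(xg)$, $g\in\mathrm U(n)$, of the function $f_\lambda=\Delta_1^{\lambda_1-\lambda_2}\cdots\Delta_{n-1}^{\lambda_{n-1}-\lambda_n}\Delta_n^{\lambda_n}$ on $\mathrm U(n)$, and $g\in \mathrm U(n)$ acts by $(g f)(x)=f(xg)$. Restrict $V_n(\lambda)$ to $\mathrm{SU}(n)$. Let $\pi_1,\dots,\pi_{n-1}$ be the fundamental weights of $\mathrm{SU}(n)$, put $\pi_n=0$, and for integers $k_1,\dots,k_{n-1}\ge 0$ put $$F_n\Big(\sum_{i=1}^{n-1}k_i\pi_i\Big)=V_n\Big(\sum_{i=1}^{n-1}k_i,\ \sum_{i=2}^{n-1}k_i,\ \dots,\ k_{n-1},\ 0\Big)$$ as a representation of $\mathrm{SU}(n)$.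 **Lemma.** Let $m\ge 2$ and $k\ge 0$ be integers, and write $V=V_{m+2}$, $F=F_{m+2}$. For all integers $\lambda_1\ge\dots\ge\lambda_{m+2}$, the space $V(\lambda)$ just described is a finite-dimensional continuous irreducible representation of $\mathrm U(m+2)$ with highest weight $\lambda$, and it remains irreducible over $\mathrm{SU}(m+2)$. As representations of $\mathrm{SU}(m+2)$, $$\begin{aligned}F(k\pi_2)\otimes F(k\pi_2)&\cong\bigoplus_{i=0}^{k}\bigoplus_{j=i}^{k}V(2k-i,2k-j,j,i,0,\dots,0)\\&\cong\bigoplus_{i=0}^{k}\bigoplus_{j=0}^{k-i}V(2k-i,2k-i-j,i+j,i,0,\dots,0)\\&\cong\bigoplus_{i=0}^{k}\bigoplus_{j=0}^{k-i}F\big(j\pi_1+(2k-2i-2j)\pi_2+j\pi_3+i\pi_4\big).\end{aligned}$$ (For $m=2$ the term $i\pi_4$ vanishes, and there are no zeros after the fourth entry.) -/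

import Mathlib

open scoped DirectSum

noncomputable section

/-- The unitary group `U(n)`. -/
abbrev UGrp (n : ℕ) := Matrix.unitaryGroup (Fin n) ℂ

/-- The special unitary group `SU(n)`. -/
abbrev SUGrp (n : ℕ) := Matrix.specialUnitaryGroup (Fin n) ℂ

/-- The element `diag(t_1, …, t_n)` of the standard maximal torus of `U(n)`. -/
def torusElt {n : ℕ} (t : Fin n → Circle) : UGrp n :=
  ⟨Matrix.diagonal (fun r => (t r : ℂ)), by
    rw [Matrix.mem_unitaryGroup_iff, Matrix.star_eq_conjTranspose, Matrix.diagonal_conjTranspose,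
      Matrix.diagonal_mul_diagonal, ← Matrix.diagonal_one]
    congr 1
    funext r
    simp [Complex.mul_conj]⟩

/-- `v` is a weight vector of weight `μ ∈ ℤⁿ`: a non-zero vector on which every
`diag(t_1, …, t_n)` acts as the scalar `t_1^{μ_1} ⋯ t_n^{μ_n}`. -/
def IsWeightVector {n : ℕ} {E : Type*} [AddCommGroup E] [Module ℂ E]
    (ρ : Representation ℂ (UGrp n) E) (μ : Fin n → ℤ) (v : E) : Prop :=
  v ≠ 0 ∧ ∀ t : Fin n → Circle, ρ (torusElt t) v = (∏ r, (t r : ℂ) ^ μ r) • v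

/-- The dominance order on `ℤⁿ`: `λ - μ` is a combination of the positive roots
`e_r - e_s` (`r < s`) with coefficients in `ℕ`, expressed through partial sums. -/
def DominanceLE {n : ℕ} (μ lam : Fin n → ℤ) : Prop :=
  ∑ r, μ r = ∑ r, lam r ∧
    ∀ r : Fin n, ∑ s ∈ Finset.univ.filter (· ≤ r), μ s ≤ ∑ s ∈ Finset.univ.filter (· ≤ r), lam s

/-- `ρ` is a (finite-dimensional, continuous) irreducible complex representation of `U(n)` with
highest weight `λ`. -/
structure IsIrrepOfHighestWeight {n : ℕ} {E : Type*} [AddCommGroup E] [Module ℂ E]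
    (ρ : Representation ℂ (UGrp n) E) (lam : Fin n → ℤ) : Prop where
  finiteDimensional : FiniteDimensional ℂ E
  continuous : ∀ (φ : E →ₗ[ℂ] ℂ) (v : E), Continuous fun g => φ (ρ g v)
  irreducible : ρ.IsIrreducible
  weight : ∃ v, IsWeightVector ρ lam v
  highest : ∀ μ v, IsWeightVector ρ μ v → DominanceLE μ lam

/-- The action of `U(n)` by right translation on functions on `U(n)`: `(g • f)(x) = f(x g)`. -/
def rightTranslation (n : ℕ) : Representation ℂ (UGrp n) (UGrp n → ℂ) where
  toFun g :=
    { toFun := fun f x => f (x * g)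
      map_add' := fun _ _ => rfl
      map_smul' := fun _ _ => rfl }
  map_one' := by ext f x; simp
  map_mul' g h := by ext f x; simp [mul_assoc]

/-- The subrepresentation generated by a vector. -/
def cyclicSubrep {G E : Type*} [Group G] [AddCommGroup E] [Module ℂ E]
    (ρ : Representation ℂ G E) (v : E) : Subrepresentation ρ where
  toSubmodule := Submodule.span ℂ (Set.range fun g => ρ g v)
  apply_mem_toSubmodule g w hw := by
    induction hw using Submodule.span_induction with
    | mem x hx =>
      obtain ⟨h, rfl⟩ := hx
      exact Submodule.subset_span ⟨g * h, by simp⟩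
    | zero => simp
    | add x y _ _ hx hy => simpa using Submodule.add_mem _ hx hy
    | smul a x _ hx => simpa using Submodule.smul_mem _ a hx

/-- The leading principal minor of size `r + 1` (with `r` counted from `0`). -/
def leadingMinor {n : ℕ} (x : Matrix (Fin n) (Fin n) ℂ) (r : Fin n) : ℂ :=
  (x.submatrix (Fin.castLE (Nat.succ_le_of_lt r.isLt))
    (Fin.castLE (Nat.succ_le_of_lt r.isLt))).det

/-- The function `Δ_1^{λ_1 - λ_2} ⋯ Δ_{n-1}^{λ_{n-1} - λ_n} Δ_n^{λ_n}` on `U(n)`, where `Δ_r` is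
the leading principal minor of size `r`. It is used for `λ_1 ≥ ⋯ ≥ λ_n`, when only the exponent of
`Δ_n = det` can be negative. -/
def highestWeightFun {n : ℕ} (lam : Fin n → ℤ) (x : UGrp n) : ℂ :=
  ∏ r : Fin n, leadingMinor (x : Matrix (Fin n) (Fin n) ℂ) r ^
    (lam r - if h : (r : ℕ) + 1 < n then lam ⟨(r : ℕ) + 1, h⟩ else 0)

/-- The underlying space of `V_n(λ)`, as a subrepresentation of the functions on `U(n)`: the span
of the right translates of `Δ_1^{λ_1 - λ_2} ⋯ Δ_{n-1}^{λ_{n-1} - λ_n} Δ_n^{λ_n}`. -/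
def spaceV {n : ℕ} (lam : Fin n → ℤ) : Subrepresentation (rightTranslation n) :=
  cyclicSubrep (rightTranslation n) (highestWeightFun lam)

/-- `V_n(λ)` as a representation of `U(n)`, for `λ_1 ≥ ⋯ ≥ λ_n`. -/
def repVU {n : ℕ} (lam : Fin n → ℤ) : Representation ℂ (UGrp n) (spaceV lam).toSubmodule :=
  (spaceV lam).toRepresentation

/-- `V_n(λ)` regarded as a representation of `SU(n)`. -/
def repV {n : ℕ} (lam : Fin n → ℤ) : Representation ℂ (SUGrp n) (spaceV lam).toSubmodule :=
  (repVU lam).comp (Submonoid.inclusion Matrix.specialUnitaryGroup_le_unitaryGroup)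

/-- The weight `(a, b, c, d, 0, …, 0) ∈ ℤⁿ`. -/
def fourRows (n : ℕ) (a b c d : ℤ) : Fin n → ℤ := fun r => [a, b, c, d].getD r 0

/-- The fundamental weight `π_i` of `SU(n)` for `1 ≤ i ≤ n - 1`, in the coordinates
`(k_1, …, k_{n-1})` of `∑ k_i π_i`. For other `i`, notably `i = n`, it is `0`. -/
def fundWeight (n i : ℕ) : Fin (n - 1) → ℕ := fun s => if (s : ℕ) + 1 = i then 1 else 0

/-- The normalised representative
`(k_1 + ⋯ + k_{n-1}, k_2 + ⋯ + k_{n-1}, …, k_{n-1}, 0) ∈ ℤⁿ` of the weight `∑ k_i π_i`. -/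
def partitionOf {n : ℕ} (k : Fin (n - 1) → ℕ) : Fin n → ℤ :=
  fun r => ∑ s : Fin (n - 1), if (r : ℕ) ≤ s then (k s : ℤ) else 0

/-- The representation `F_n(∑ k_i π_i)` of `SU(n)`. -/
def repF {n : ℕ} (k : Fin (n - 1) → ℕ) :
    Representation ℂ (SUGrp n) (spaceV (partitionOf k)).toSubmodule :=
  repV (partitionOf k)

end

noncomputable section

open Matrix
open scoped ComplexOrder TensorProduct

/-! Matrix coefficients are treated as polynomial functions on all `n × n` matrices, in which `U(n)`
is Zariski dense (`eq_zero_of_unitary`), as are the products of a lower and an invertible upper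
triangular matrix (`eq_zero_of_lower_mul_upper`). Up to a power of the determinant, `V(λ)` is the
space `eqvFun ν` of polynomial functions transforming by a character under left multiplication by
lower triangular matrices (Borel–Weil). By density of the products `L * U`, a highest weight vector
there is determined by its value at `1`. Every nonzero stable subspace contains a highest weight
vector (`IsPolynomialRep.exists_isHighest`), and averaging over `U(n)` provides orthogonal
complements; a proper stable subspace would share that vector with its complement, whence
irreducibility (`eqvFun_irreducible`). It persists over `SU(n)` because `U(n)` is `SU(n)` times
scalars.

An element of the tensor square of `F(kπ_2)` is a function of two matrices that depends only on
their first two rows, up to determinants. Upper triangular matrices act on pairs of planes with a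
dense orbit, so a highest weight vector is determined by its value at `(1, basePoint)`
(`eq_zero_of_pairEval_basePoint`): multiplicities are at most one. The torus elements preserving
both planes of that pair, together with dominance, restrict the weights to `(2k - i, 2k - j, j, i,
0, …)` with `i ≤ j ≤ k` (`exists_eq_fourRowWeight`). All of these occur, realised by products of
three explicit vectors for `k = 1` (`exists_isHighest_fourRowWeight`). Matrix coefficients against
these vectors give the isomorphism (`exists_equiv_pi_eqvFun`). The other two forms are a reindexing,
and for `m = 2` a determinant twist invisible on `SU(4)`. -/

/-- The algebra of polynomial functions on a complex vector space. -/
def polyFun (X : Type*) [AddCommGroup X] [Module ℂ X] : Subalgebra ℂ (X → ℂ) :=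
  Algebra.adjoin ℂ (Set.range fun (l : X →ₗ[ℂ] ℂ) (x : X) => l x)

/-! ### Polynomial functions on complex vector spaces. -/

section polyFun

variable {X Y : Type*} [AddCommGroup X] [Module ℂ X] [AddCommGroup Y] [Module ℂ Y]

theorem linear_mem_polyFun (l : X →ₗ[ℂ] ℂ) : (fun x => l x) ∈ polyFun X :=
  Algebra.subset_adjoin ⟨l, rfl⟩

theorem const_mem_polyFun (c : ℂ) : (fun _ => c) ∈ polyFun X :=
  (polyFun X).algebraMap_mem c

theorem polyFun_comp {f : X → ℂ} (hf : f ∈ polyFun X) {g : Y → X}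
    (hg : ∀ l : X →ₗ[ℂ] ℂ, (fun y => l (g y)) ∈ polyFun Y) : (fun y => f (g y)) ∈ polyFun Y := by
  induction hf using Algebra.adjoin_induction with
  | mem f hf =>
    obtain ⟨l, rfl⟩ := hf
    exact hg l
  | algebraMap r => exact const_mem_polyFun r
  | add f g _ _ hf hg => exact add_mem hf hg
  | mul f g _ _ hf hg => exact mul_mem hf hg

theorem polyFun_comp_linear {f : X → ℂ} (hf : f ∈ polyFun X) (g : Y →ₗ[ℂ] X) :
    (fun y => f (g y)) ∈ polyFun Y :=
  polyFun_comp hf fun l => linear_mem_polyFun (l.comp g)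

theorem mem_polyFun_of_forall_entry {m n : Type*} [Finite m] [Finite n]
    {f : Matrix m n ℂ → ℂ} (hf : f ∈ polyFun (Matrix m n ℂ)) {g : Y → Matrix m n ℂ}
    (hg : ∀ i j, (fun y => g y i j) ∈ polyFun Y) : (fun y => f (g y)) ∈ polyFun Y := by
  classical
  have := Fintype.ofFinite m
  have := Fintype.ofFinite n
  refine polyFun_comp hf fun l => ?_
  have : (fun y => l (g y)) = ∑ i, ∑ j, l (Matrix.single i j 1) • fun y => g y i j := by
    funext y
    conv_lhs => rw [Matrix.matrix_eq_sum_single (g y)]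
    simp only [map_sum, Finset.sum_apply, Pi.smul_apply, smul_eq_mul]
    refine Finset.sum_congr rfl fun i _ => Finset.sum_congr rfl fun j _ => ?_
    rw [← mul_one (g y i j), ← smul_eq_mul, ← Matrix.smul_single, map_smul, smul_eq_mul]
    simp [mul_comm]
  rw [this]
  exact sum_mem fun i _ => sum_mem fun j _ => Subalgebra.smul_mem _ (hg i j) _

theorem entry_mem_polyFun {m n : Type*} (i : m) (j : n) :
    (fun x : Matrix m n ℂ => x i j) ∈ polyFun (Matrix m n ℂ) :=
  linear_mem_polyFun (Matrix.entryLinearMap ℂ ℂ i j)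

theorem exists_mvPolynomial {σ : Type*} [Finite σ] {f : (σ → ℂ) → ℂ} (hf : f ∈ polyFun (σ → ℂ)) :
    ∃ p : MvPolynomial σ ℂ, ∀ t, f t = MvPolynomial.eval t p := by
  classical
  have := Fintype.ofFinite σ
  induction hf using Algebra.adjoin_induction with
  | mem f hf =>
    obtain ⟨l, rfl⟩ := hf
    refine ⟨∑ i, MvPolynomial.C (l (Pi.single i 1)) * MvPolynomial.X i, fun t => ?_⟩
    conv_lhs => rw [← LinearMap.sum_single_apply (fun _ : σ => ℂ) t]
    simp only [map_sum, map_mul, MvPolynomial.eval_C, MvPolynomial.eval_X]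
    refine Finset.sum_congr rfl fun i _ => ?_
    rw [mul_comm, ← smul_eq_mul, ← map_smul, ← Pi.single_smul, smul_eq_mul, mul_one]
  | algebraMap r => exact ⟨MvPolynomial.C r, fun t => by simp⟩
  | add f g _ _ hf hg =>
    obtain ⟨p, hp⟩ := hf
    obtain ⟨q, hq⟩ := hg
    exact ⟨p + q, fun t => by simp [hp, hq]⟩
  | mul f g _ _ hf hg =>
    obtain ⟨p, hp⟩ := hf
    obtain ⟨q, hq⟩ := hg
    exact ⟨p * q, fun t => by simp [hp, hq]⟩

theorem exists_polynomial {f : ℂ → ℂ} (hf : f ∈ polyFun ℂ) :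
    ∃ p : Polynomial ℂ, ∀ t, f t = p.eval t := by
  induction hf using Algebra.adjoin_induction with
  | mem f hf =>
    obtain ⟨l, rfl⟩ := hf
    refine ⟨Polynomial.C (l 1) * Polynomial.X, fun t => ?_⟩
    have : l (t • 1) = t • l 1 := map_smul l t 1
    rw [smul_eq_mul, mul_one, smul_eq_mul] at this
    simp only [this, Polynomial.eval_mul, Polynomial.eval_C, Polynomial.eval_X, mul_comm]
  | algebraMap r => exact ⟨Polynomial.C r, fun t => by simp⟩
  | add f g _ _ hf hg =>
    obtain ⟨p, hp⟩ := hf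
    obtain ⟨q, hq⟩ := hg
    exact ⟨p + q, fun t => by simp [hp, hq]⟩
  | mul f g _ _ hf hg =>
    obtain ⟨p, hp⟩ := hf
    obtain ⟨q, hq⟩ := hg
    exact ⟨p * q, fun t => by simp [hp, hq]⟩

theorem continuous_of_mem_polyFun {X : Type*} [AddCommGroup X] [Module ℂ X]
    [TopologicalSpace X] [IsTopologicalAddGroup X] [ContinuousSMul ℂ X] [T2Space X]
    [FiniteDimensional ℂ X] {f : X → ℂ} (hf : f ∈ polyFun X) : Continuous f := by
  induction hf using Algebra.adjoin_induction with
  | mem f hf =>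
    obtain ⟨l, rfl⟩ := hf
    exact l.continuous_of_finiteDimensional
  | algebraMap r => exact continuous_const
  | add f g _ _ hf hg => exact hf.add hg
  | mul f g _ _ hf hg => exact hf.mul hg

/-- A polynomial function of one variable with infinitely many zeros vanishes. -/
theorem eq_zero_of_infinite_zeros {f : ℂ → ℂ} (hf : f ∈ polyFun ℂ) {S : Set ℂ} (hS : S.Infinite)
    (h : ∀ z ∈ S, f z = 0) (z : ℂ) : f z = 0 := by
  obtain ⟨p, hp⟩ := exists_polynomial hf
  have : p = 0 := p.eq_zero_of_infinite_isRoot (hS.mono fun z hz => by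
    simpa [Polynomial.IsRoot, ← hp] using h z hz)
  simp [hp, this]

theorem eq_zero_of_infinite_pi {σ : Type*} [Finite σ] {f : (σ → ℂ) → ℂ} (hf : f ∈ polyFun (σ → ℂ))
    {S : Set ℂ} (hS : S.Infinite) (h : ∀ t, (∀ i, t i ∈ S) → f t = 0) (t : σ → ℂ) : f t = 0 := by
  obtain ⟨p, hp⟩ := exists_mvPolynomial hf
  have : p = 0 := MvPolynomial.funext_set (fun _ => S) (fun _ => hS) fun x hx => by
    simpa [← hp] using h x fun i => hx i (Set.mem_univ i)
  simp [hp, this]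

/-- Polynomials over `ℂ` form a domain. This later allows a Plücker factor to be cancelled. -/
theorem polyFun_mul_eq_zero {m n : Type*} [Finite m] [Finite n] {f g : Matrix m n ℂ → ℂ}
    (hf : f ∈ polyFun (Matrix m n ℂ))
    (hg : g ∈ polyFun (Matrix m n ℂ)) (h : ∀ x, f x * g x = 0) : (∀ x, f x = 0) ∨ ∀ x, g x = 0 := by
  let φ : (m × n → ℂ) →ₗ[ℂ] Matrix m n ℂ :=
    { toFun := fun t => Matrix.of fun i j => t (i, j)
      map_add' := fun _ _ => rfl
      map_smul' := fun _ _ => rfl }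
  have hφ : ∀ x, φ (fun ij => x ij.1 ij.2) = x := fun x => rfl
  obtain ⟨p, hp⟩ := exists_mvPolynomial (polyFun_comp_linear hf φ)
  obtain ⟨q, hq⟩ := exists_mvPolynomial (polyFun_comp_linear hg φ)
  have : p * q = 0 := MvPolynomial.funext fun t => by simp [← hp, ← hq, h]
  rcases mul_eq_zero.1 this with h0 | h0
  · exact .inl fun x => by rw [← hφ x, hp, h0, map_zero]
  · exact .inr fun x => by rw [← hφ x, hq, h0, map_zero]

end polyFun

/-! ### Zariski density of unitary matrices and of triangular products. -/

section Density

variable {n : ℕ}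

theorem mul_left_mem_polyFun {f : Matrix (Fin n) (Fin n) ℂ → ℂ} (hf : f ∈ polyFun _)
    (a : Matrix (Fin n) (Fin n) ℂ) : (fun x => f (a * x)) ∈ polyFun (Matrix (Fin n) (Fin n) ℂ) :=
  polyFun_comp_linear hf (LinearMap.mulLeft ℂ a)

theorem mul_right_mem_polyFun {f : Matrix (Fin n) (Fin n) ℂ → ℂ} (hf : f ∈ polyFun _)
    (a : Matrix (Fin n) (Fin n) ℂ) : (fun x => f (x * a)) ∈ polyFun (Matrix (Fin n) (Fin n) ℂ) :=
  polyFun_comp_linear hf (LinearMap.mulRight ℂ a)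

/-- A polynomial function vanishing on the Hermitian matrices vanishes. -/
theorem eq_zero_of_isHermitian {f : Matrix (Fin n) (Fin n) ℂ → ℂ} (hf : f ∈ polyFun _)
    (h : ∀ x : Matrix (Fin n) (Fin n) ℂ, x.IsHermitian → f x = 0) (x) : f x = 0 := by
  set H : Matrix (Fin n) (Fin n) ℂ := (1 / 2 : ℂ) • (x + xᴴ) with hH
  set K : Matrix (Fin n) (Fin n) ℂ := (-Complex.I / 2) • (x - xᴴ) with hK
  have hx : H + Complex.I • K = x := by
    rw [hH, hK, smul_smul]
    ext i j
    simp only [Matrix.add_apply, Matrix.smul_apply, Matrix.sub_apply, smul_eq_mul]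
    linear_combination (-(x i j - xᴴ i j) / 2) * Complex.I_mul_I
  have hHh : H.IsHermitian := by
    rw [Matrix.IsHermitian, hH, Matrix.conjTranspose_smul, Matrix.conjTranspose_add,
      Matrix.conjTranspose_conjTranspose, add_comm]
    simp
  have hKh : K.IsHermitian := by
    rw [Matrix.IsHermitian, hK, Matrix.conjTranspose_smul, Matrix.conjTranspose_sub,
      Matrix.conjTranspose_conjTranspose, ← neg_sub x, smul_neg, ← neg_smul]
    congr 1
    simp
    ring
  -- `H + z • K` is Hermitian for real `z`, so this polynomial in `z` vanishes on `ℝ` and hence at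
  -- `z = i`, which gives `x`.
  have hpoly : (fun z : ℂ => f (H + z • K)) ∈ polyFun ℂ := by
    refine mem_polyFun_of_forall_entry hf fun i j => ?_
    simp only [Matrix.add_apply, Matrix.smul_apply, smul_eq_mul]
    exact add_mem (const_mem_polyFun _)
      (linear_mem_polyFun (X := ℂ) ((LinearMap.id : ℂ →ₗ[ℂ] ℂ).smulRight (K i j)))
  have := eq_zero_of_infinite_zeros hpoly (S := Set.range ((↑) : ℝ → ℂ))
    (Set.infinite_range_of_injective Complex.ofReal_injective) (by
      rintro _ ⟨r, rfl⟩
      refine h _ (hHh.add ?_)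
      rw [Matrix.IsHermitian, Matrix.conjTranspose_smul, hKh.eq]
      simp) Complex.I
  rwa [hx] at this

/-- Hermitian matrices are unitarily diagonalisable, and for fixed `V` the value is polynomial in
the diagonal entries, so an infinite set `S` of entries suffices. The unit circle yields unitary
matrices, the positive reals positive definite ones. -/
theorem eq_zero_of_conj_diagonal {f : Matrix (Fin n) (Fin n) ℂ → ℂ} (hf : f ∈ polyFun _)
    {S : Set ℂ} (hS : S.Infinite)
    (h : ∀ (V : Matrix.unitaryGroup (Fin n) ℂ) (t : Fin n → ℂ), (∀ i, t i ∈ S) →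
      f (V.1 * diagonal t * V.1ᴴ) = 0) (x) : f x = 0 := by
  refine eq_zero_of_isHermitian hf (fun x hx => ?_) x
  rw [hx.spectral_theorem]
  have hpoly : (fun t : Fin n → ℂ =>
      f (hx.eigenvectorUnitary.1 * diagonal t * hx.eigenvectorUnitary.1ᴴ)) ∈ polyFun _ := by
    refine mem_polyFun_of_forall_entry (mul_left_mem_polyFun
      (mul_right_mem_polyFun hf hx.eigenvectorUnitary.1ᴴ) hx.eigenvectorUnitary.1) fun i j => ?_
    by_cases hij : i = j
    · subst hij
      simpa using linear_mem_polyFun (LinearMap.proj (R := ℂ) (φ := fun _ : Fin n => ℂ) i)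
    · simpa [Matrix.diagonal_apply_ne _ hij] using const_mem_polyFun (X := Fin n → ℂ) 0
  exact eq_zero_of_infinite_pi hpoly hS (fun t ht => h _ t ht) _

theorem infinite_circle : {z : ℂ | ‖z‖ = 1}.Infinite := by
  refine ((Set.Ioc_infinite (show -Real.pi < Real.pi by linarith [Real.pi_pos])).image
    (f := fun r : ℝ => (Circle.exp r : ℂ)) fun a ha b hb hab => ?_).mono ?_
  · exact Circle.invOn_arg_exp.1.injOn ha hb (Subtype.ext hab)
  · rintro _ ⟨z, -, rfl⟩
    simp

/-- The unitary group is Zariski dense in the space of all matrices. -/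
theorem eq_zero_of_unitary {f : Matrix (Fin n) (Fin n) ℂ → ℂ} (hf : f ∈ polyFun _)
    (h : ∀ u : UGrp n, f u = 0) (x) : f x = 0 := by
  refine eq_zero_of_conj_diagonal hf infinite_circle (fun V t ht => ?_) x
  have hd : diagonal t ∈ Matrix.unitaryGroup (Fin n) ℂ := by
    rw [Matrix.mem_unitaryGroup_iff, Matrix.star_eq_conjTranspose, Matrix.diagonal_conjTranspose,
      Matrix.diagonal_mul_diagonal, ← Matrix.diagonal_one]
    congr 1
    funext r
    have := ht r
    rw [Set.mem_ofPred_eq] at this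
    simp [Complex.mul_conj, Complex.normSq_eq_norm_sq, this]
  have := h (V * ⟨_, hd⟩ * star V)
  rwa [Submonoid.coe_mul, Submonoid.coe_mul, Unitary.coe_star, Matrix.star_eq_conjTranspose] at this

/-- The products of a lower and an upper triangular matrix are Zariski dense. -/
theorem eq_zero_of_lower_mul_upper {f : Matrix (Fin n) (Fin n) ℂ → ℂ} (hf : f ∈ polyFun _)
    (h : ∀ L U : Matrix (Fin n) (Fin n) ℂ, (∀ i j, i < j → L i j = 0) → (∀ i j, j < i → U i j = 0) →
      IsUnit U → f (L * U) = 0) (x) : f x = 0 := by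
  refine eq_zero_of_conj_diagonal hf (S := ((↑) : ℝ → ℂ) '' Set.Ioi 0)
    ((Set.Ioi_infinite 0).image Complex.ofReal_injective.injOn) (fun V t ht => ?_) x
  have hS : (V.1 * diagonal t * V.1ᴴ).PosDef := by
    have hd : (diagonal t).PosDef := Matrix.PosDef.diagonal fun i => by
      obtain ⟨r, hr, hri⟩ := ht i
      rw [← hri]
      exact_mod_cast hr
    have := hd.conjTranspose_mul_mul_same (B := V.1ᴴ) (by
      apply Matrix.mulVec_injective_of_isUnit
      have : V.1ᴴ = ((star V : UGrp n) : Matrix (Fin n) (Fin n) ℂ) := rfl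
      rw [this]
      exact (Unitary.toUnits (star V)).isUnit)
    simpa using this
  -- The LDL decomposition reads `(lower * diag) * lowerᴴ`, whose last factor is upper triangular
  -- and invertible.
  rw [← LDL.lower_conj_diag hS]
  have hlow : ∀ i j, i < j → LDL.lower hS i j = 0 := by
    have hb : (LDL.lowerInv hS).BlockTriangular OrderDual.toDual := fun i j hij =>
      LDL.lowerInv_triangular hS hij
    intro i j hij
    exact Matrix.blockTriangular_inv_of_blockTriangular hb hij
  refine h _ _ (fun i j hij => ?_) (fun i j hij => ?_) ?_
  · rw [LDL.diag, Matrix.mul_diagonal, hlow i j hij, zero_mul]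
  · rw [Matrix.conjTranspose_apply, hlow j i hij, star_zero]
  · rw [← Matrix.star_eq_conjTranspose]
    refine IsUnit.star ?_
    rw [LDL.lower]
    exact Matrix.isUnit_nonsing_inv_iff.2 (isUnit_of_invertible _)

end Density

/-! ### Polynomials with vector coefficients. -/

section VectorPolynomial

variable {E : Type*} [AddCommGroup E] [Module ℂ E]

/-- A map with polynomial coordinates is a polynomial with vector coefficients. -/
theorem exists_vector_coeff [FiniteDimensional ℂ E] {σ : Type*} [Finite σ] {F : (σ → ℂ) → E}
    (hF : ∀ φ : E →ₗ[ℂ] ℂ, (fun t => φ (F t)) ∈ polyFun (σ → ℂ)) :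
    ∃ (S : Finset (σ →₀ ℕ)) (w : (σ →₀ ℕ) → E),
      ∀ t, F t = ∑ μ ∈ S, (μ.prod fun i k => t i ^ k) • w μ := by
  classical
  let b := Module.finBasis ℂ E
  choose p hp using fun i => exists_mvPolynomial (hF (b.coord i))
  refine ⟨Finset.univ.biUnion fun i => (p i).support, fun μ => ∑ i, (p i).coeff μ • b i,
    fun t => ?_⟩
  rw [← b.sum_repr (F t)]
  simp_rw [Finset.smul_sum]
  rw [Finset.sum_comm]
  refine Finset.sum_congr rfl fun i _ => ?_
  have : b.repr (F t) i = MvPolynomial.eval t (p i) := hp i t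
  rw [this, MvPolynomial.eval_eq, Finset.sum_smul]
  refine Finset.sum_subset_zero_on_sdiff (Finset.subset_biUnion_of_mem (fun i => (p i).support)
    (Finset.mem_univ i)) (fun μ hμ => ?_) fun μ _ => ?_
  · rw [MvPolynomial.notMem_support_iff.1 (Finset.mem_sdiff.1 hμ).2]
    simp
  · rw [smul_smul, mul_comm]
    rfl

/-- The coefficients of a vector-valued polynomial lie in every subspace containing its values. -/
theorem vector_coeff_mem {σ : Type*} [Finite σ] (W : Submodule ℂ E) (S : Finset (σ →₀ ℕ))
    (w : (σ →₀ ℕ) → E)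
    (h : ∀ t : σ → ℂ, (∀ i, t i ≠ 0) → ∑ μ ∈ S, (μ.prod fun i k => t i ^ k) • w μ ∈ W)
    (μ : σ →₀ ℕ) (hμ : μ ∈ S) : w μ ∈ W := by
  classical
  by_contra hw
  obtain ⟨φ, hφ, hW⟩ := Submodule.exists_le_ker_of_notMem hw
  -- A functional killing `W` but not `w μ` leaves a scalar polynomial that vanishes wherever all
  -- coordinates are nonzero, hence identically.
  let p : MvPolynomial σ ℂ := ∑ ν ∈ S, MvPolynomial.monomial ν (φ (w ν))
  have hp : p = 0 := MvPolynomial.funext_set (fun _ => {0}ᶜ)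
    (fun _ => (Set.finite_singleton 0).infinite_compl) fun t ht => by
      have := hW (h t fun i => ht i (Set.mem_univ i))
      simpa [p, MvPolynomial.eval_monomial, mul_comm] using this
  have : p.coeff μ = φ (w μ) := by simp [p, MvPolynomial.coeff_sum, MvPolynomial.coeff_monomial, hμ]
  exact hφ (by rw [← this, hp, MvPolynomial.coeff_zero])

end VectorPolynomial

/-! ### Polynomial representations: invariant forms and highest weight vectors. -/

section PolynomialRepresentation

variable {n : ℕ} {E : Type*} [AddCommGroup E] [Module ℂ E]

/-- A representation of the monoid of `n × n` matrices with polynomial matrix coefficients. -/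
def IsPolynomialRep (ρ : Representation ℂ (Matrix (Fin n) (Fin n) ℂ) E) : Prop :=
  ∀ (φ : E →ₗ[ℂ] ℂ) (v : E), (fun a => φ (ρ a v)) ∈ polyFun (Matrix (Fin n) (Fin n) ℂ)

/-- Every upper triangular matrix `b` acts on `v` by the scalar `∏ i, b i i ^ ν i`. -/
def IsHighest (ρ : Representation ℂ (Matrix (Fin n) (Fin n) ℂ) E) (ν : Fin n → ℕ) (v : E) : Prop :=
  ∀ b : Matrix (Fin n) (Fin n) ℂ, (∀ i j, j < i → b i j = 0) → ρ b v = (∏ i, b i i ^ ν i) • v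

variable {ρ : Representation ℂ (Matrix (Fin n) (Fin n) ℂ) E}

/-- The unitarian trick: a subspace stable under `U(n)` is stable under all matrices. -/
theorem IsPolynomialRep.stable_of_unitary (hρ : IsPolynomialRep ρ) {W : Submodule ℂ E}
    (hW : ∀ (u : UGrp n), ∀ v ∈ W, ρ u v ∈ W) (a : Matrix (Fin n) (Fin n) ℂ) (v : E) (hv : v ∈ W) :
    ρ a v ∈ W := by
  by_contra h
  obtain ⟨φ, hφ, hker⟩ := Submodule.exists_le_ker_of_notMem h
  exact hφ (eq_zero_of_unitary (hρ φ v) (fun u => hker (hW u v hv)) a)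

/-- The two conjugations cancel. This makes `a ↦ B (ρ aᴴ w) v` polynomial, for `B` conjugate-linear
in its first argument. -/
theorem conj_conjTranspose_mem_polyFun {f : Matrix (Fin n) (Fin n) ℂ → ℂ} (hf : f ∈ polyFun _) :
    (fun a => (starRingEnd ℂ) (f aᴴ)) ∈ polyFun (Matrix (Fin n) (Fin n) ℂ) := by
  induction hf using Algebra.adjoin_induction with
  | mem f hf =>
    obtain ⟨l, rfl⟩ := hf
    exact linear_mem_polyFun
      { toFun := fun a => (starRingEnd ℂ) (l aᴴ)
        map_add' := by simp [Matrix.conjTranspose_add]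
        map_smul' := by simp [Matrix.conjTranspose_smul] }
  | algebraMap r =>
    exact const_mem_polyFun (X := Matrix (Fin n) (Fin n) ℂ) ((starRingEnd ℂ) r)
  | add f g _ _ hf hg =>
    simp only [Pi.add_apply, map_add]
    exact add_mem hf hg
  | mul f g _ _ hf hg =>
    simp only [Pi.mul_apply, map_mul]
    exact mul_mem hf hg

instance compactSpace_unitaryGroup : CompactSpace (UGrp n) := by
  suffices h : IsCompact ((Matrix.unitaryGroup (Fin n) ℂ : Submonoid _) :
    Set (Matrix (Fin n) (Fin n) ℂ)) from isCompact_iff_compactSpace.1 h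
  refine IsCompact.of_isClosed_subset (s := Set.univ.pi fun _ => Set.univ.pi fun _ =>
    Metric.closedBall (0 : ℂ) 1) (isCompact_univ_pi fun _ => isCompact_univ_pi fun _ =>
      isCompact_closedBall _ _) ?_ fun U hU i _ j _ => ?_
  · have : ((Matrix.unitaryGroup (Fin n) ℂ : Submonoid _) : Set (Matrix (Fin n) (Fin n) ℂ)) =
        {A | A * star A = 1} := by
      ext A
      exact Matrix.mem_unitaryGroup_iff
    rw [this]
    exact isClosed_eq (by fun_prop) continuous_const
  · simpa using entry_norm_bound_of_unitary hU i j

theorem IsPolynomialRep.continuous (hρ : IsPolynomialRep ρ) (φ : E →ₗ[ℂ] ℂ) (v : E) :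
    Continuous fun u : UGrp n => φ (ρ u v) :=
  (continuous_of_mem_polyFun (hρ φ v)).comp continuous_subtype_val

open MeasureTheory in
/-- Averaging over `U(n)`: a polynomial representation has a definite sesquilinear form for which
the adjoint of `ρ a` is `ρ aᴴ`. -/
theorem IsPolynomialRep.exists_invariant_form [FiniteDimensional ℂ E] (hρ : IsPolynomialRep ρ) :
    ∃ B : E →ₗ⋆[ℂ] E →ₗ[ℂ] ℂ, (∀ v, v ≠ 0 → B v v ≠ 0) ∧
      ∀ a v w, B w (ρ a v) = B (ρ aᴴ w) v := by
  let b := Module.finBasis ℂ E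
  let _ : MeasurableSpace (UGrp n) := borel _
  have : BorelSpace (UGrp n) := ⟨rfl⟩
  let μ : Measure (UGrp n) := Measure.haar
  -- The standard form of a basis transported by `g⁻¹`; the inverse turns left invariance of Haar
  -- measure into invariance of the integral.
  let K : E → E → UGrp n → ℂ := fun w v g =>
    ∑ i, (starRingEnd ℂ) (b.coord i (ρ (g⁻¹ : UGrp n) w)) * b.coord i (ρ (g⁻¹ : UGrp n) v)
  have hcont : ∀ v i, Continuous fun g : UGrp n => b.coord i (ρ (g⁻¹ : UGrp n) v) := fun v i =>
    (hρ.continuous (b.coord i) v).comp continuous_inv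
  have hK : ∀ w v, Continuous (K w v) := fun w v => continuous_finsetSum _ fun i _ =>
    (Complex.continuous_conj.comp (hcont w i)).mul (hcont v i)
  have hint : ∀ w v, Integrable (K w v) μ := fun w v =>
    (hK w v).integrable_of_hasCompactSupport (HasCompactSupport.of_compactSpace _)
  let B : E →ₗ⋆[ℂ] E →ₗ[ℂ] ℂ := LinearMap.mk₂'ₛₗ _ _ (fun w v => ∫ g, K w v g ∂μ)
    (fun w w' v => by
      rw [← integral_add (hint _ _) (hint _ _)]
      congr 1; funext g
      simp only [K, map_add, add_mul, Finset.sum_add_distrib])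
    (fun c w v => by
      rw [smul_eq_mul, ← integral_const_mul]
      congr 1; funext g
      simp only [K, map_smul, smul_eq_mul, map_mul, Finset.mul_sum, mul_assoc])
    (fun w v v' => by
      rw [← integral_add (hint _ _) (hint _ _)]
      congr 1; funext g
      simp only [K, map_add, mul_add, Finset.sum_add_distrib])
    (fun c w v => by
      simp only [RingHom.id_apply]
      rw [smul_eq_mul, ← integral_const_mul]
      congr 1; funext g
      simp only [K, map_smul, smul_eq_mul, Finset.mul_sum]
      exact Finset.sum_congr rfl fun i _ => by ring)
  have hB : ∀ w v, B w v = ∫ g, K w v g ∂μ := fun w v => rfl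
  refine ⟨B, fun v hv => ?_, fun a v w => ?_⟩
  · let R : UGrp n → ℝ := fun g => ∑ i, ‖b.coord i (ρ (g⁻¹ : UGrp n) v)‖ ^ 2
    have hKR : ∀ g, K v v g = (R g : ℂ) := fun g => by
      simp only [K, R, Complex.ofReal_sum]
      exact Finset.sum_congr rfl fun i _ => by rw [Complex.conj_mul']; simp
    have hpos : 0 < ∫ g, R g ∂μ := by
      refine Continuous.integral_pos_of_hasCompactSupport_nonneg_nonzero (x := 1)
        (continuous_finsetSum _ fun i _ => (hcont v i).norm.pow 2)
        (HasCompactSupport.of_compactSpace _) (fun g => Finset.sum_nonneg fun i _ => by positivity)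
        fun h0 => hv ?_
      rw [Finset.sum_eq_zero_iff_of_nonneg fun i _ => by positivity] at h0
      refine b.ext_elem fun i => ?_
      have := h0 i (Finset.mem_univ i)
      simpa using this
    rw [hB]
    simp_rw [hKR]
    rw [integral_complex_ofReal]
    exact_mod_cast hpos.ne'
  · have hu : ∀ u : UGrp n, ∀ x y, B (ρ u x) (ρ u y) = B x y := fun u x y => by
      rw [hB, hB, ← integral_mul_left_eq_self (K x y) u⁻¹]
      congr 1; funext g
      have : ((u⁻¹ * g)⁻¹ : UGrp n) = g⁻¹ * u := by group
      simp only [K, this, Submonoid.coe_mul, map_mul, Module.End.mul_apply]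
    let φ : E →ₗ[ℂ] ℂ :=
      { toFun := fun e => (starRingEnd ℂ) (B e v)
        map_add' := by simp
        map_smul' := by simp }
    have hφ : ∀ e, (starRingEnd ℂ) (φ e) = B e v := fun e => by simp [φ]
    -- Both sides are polynomial in `a`, so it suffices to compare them at unitary `u`, where `uᴴ =
    -- u⁻¹` and `hu` applies.
    have hp : (fun a => B w (ρ a v) - B (ρ aᴴ w) v) ∈ polyFun (Matrix (Fin n) (Fin n) ℂ) := by
      simp_rw [← hφ]
      exact sub_mem (hρ (B w) v) (conj_conjTranspose_mem_polyFun (hρ φ w))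
    refine sub_eq_zero.1 (eq_zero_of_unitary hp (fun u => sub_eq_zero.2 ?_) a)
    have hs : (u.1ᴴ : Matrix (Fin n) (Fin n) ℂ) = (u⁻¹ : UGrp n) := rfl
    rw [hs, ← hu u (ρ (u⁻¹ : UGrp n) w) v, ← Module.End.mul_apply, ← map_mul, ← Submonoid.coe_mul]
    simp

/-- Every non-zero stable subspace contains a highest weight vector. -/
theorem IsPolynomialRep.exists_isHighest [FiniteDimensional ℂ E] (hρ : IsPolynomialRep ρ)
    {W : Submodule ℂ E} (hW : ∀ a, ∀ v ∈ W, ρ a v ∈ W) (hne : W ≠ ⊥) :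
    ∃ ν, ∃ v ∈ W, v ≠ 0 ∧ IsHighest ρ ν v := by
  classical
  -- Conjugation by `D` multiplies the entry `(i, j)` by `2 ^ (j - i)`, so entries above the
  -- diagonal raise the modulus of a `D`-eigenvalue. They cannot affect an eigenvector in `W` whose
  -- eigenvalue has maximal modulus.
  let D : Matrix (Fin n) (Fin n) ℂ := diagonal fun i => 2 ^ (n - 1 - (i : ℕ))
  let D' : Matrix (Fin n) (Fin n) ℂ := diagonal fun i => (2 ^ (n - 1 - (i : ℕ)))⁻¹
  have hDD : D' * D = 1 := by
    rw [Matrix.diagonal_mul_diagonal, ← Matrix.diagonal_one]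
    congr 1; funext i
    exact inv_mul_cancel₀ (by positivity)
  let S : Set ℂ := {c | ∃ v ∈ W, v ≠ 0 ∧ ρ D v = c • v}
  have hSfin : S.Finite := (Module.End.finite_hasEigenvalue (ρ D)).subset fun c ⟨v, _, hv, hc⟩ =>
    Module.End.hasEigenvalue_of_hasEigenvector (x := v)
      ⟨Module.End.mem_eigenspace_iff.2 hc, hv⟩
  have hSne : S.Nonempty := by
    have := Submodule.nontrivial_iff_ne_bot.2 hne
    obtain ⟨c, hc⟩ := Module.End.exists_eigenvalue ((ρ D).restrict (hW D))
    obtain ⟨v, hv⟩ := hc.exists_hasEigenvector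
    refine ⟨c, v, v.2, fun h => hv.2 (Subtype.ext h), ?_⟩
    simpa using congrArg Subtype.val hv.apply_eq_smul
  obtain ⟨c, ⟨v₀, hv₀W, hv₀, hv₀c⟩, hmax⟩ := Set.exists_max_image S (fun c => ‖c‖) hSfin hSne
  have hc0 : c ≠ 0 := fun h => hv₀ (by
    rw [h, zero_smul] at hv₀c
    rw [← Module.End.one_apply (R := ℂ) v₀, ← map_one ρ, ← hDD, map_mul, Module.End.mul_apply,
      hv₀c, map_zero])
  have key : ∀ v ∈ W, ρ D v = c • v → ∀ b : Matrix (Fin n) (Fin n) ℂ,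
      (∀ i j, j < i → b i j = 0) → ρ b v = ρ (diagonal fun i => b i i) v := by
    intro v hv hvc b hb
    -- A degeneration of `b` (at `τ = 1`) to its diagonal part (at `τ = 0`); truncated subtraction
    -- is harmless as `b` vanishes below the diagonal. From `D * β τ = β (2 * τ) * D`, the
    -- coefficient of `τ ^ m` in `ρ (β τ) v` lies in the `c * 2 ^ m`-eigenspace of `D`, so it is
    -- zero for `m > 0` by maximality.
    let β : ℂ → Matrix (Fin n) (Fin n) ℂ := fun τ => Matrix.of fun i j =>
      b i j * τ ^ ((j : ℕ) - (i : ℕ))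
    have hβ1 : β 1 = b := by ext i j; simp [β]
    have hβ0 : β 0 = diagonal fun i => b i i := by
      ext i j
      rcases lt_trichotomy i j with h | h | h
      · have : (j : ℕ) - (i : ℕ) ≠ 0 := by omega
        simp [β, h.ne, this]
      · subst h; simp [β]
      · simp [β, hb i j h, h.ne']
    have hβD : ∀ τ, D * β τ = β (2 * τ) * D := fun τ => by
      ext i j
      rw [Matrix.diagonal_mul, Matrix.mul_diagonal]
      simp only [β, Matrix.of_apply]
      rcases lt_or_ge j i with h | h
      · simp [hb i j h]
      · have h1 : n - 1 - (i : ℕ) = ((j : ℕ) - (i : ℕ)) + (n - 1 - (j : ℕ)) := by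
          have : (i : ℕ) ≤ j := h
          omega
        rw [h1, pow_add, mul_pow]
        ring
    obtain ⟨T, w, hw⟩ := exists_vector_coeff (σ := Unit) (F := fun t => ρ (β (t ())) v)
      fun φ => mem_polyFun_of_forall_entry (hρ φ v) fun i j => by
        simp only [β, Matrix.of_apply]
        exact mul_mem (const_mem_polyFun _) (pow_mem (linear_mem_polyFun
          (LinearMap.proj (R := ℂ) (φ := fun _ : Unit => ℂ) ())) _)
    have hwW := vector_coeff_mem W T w fun t _ => by rw [← hw]; exact hW _ _ hv
    have hwD : ∀ μ ∈ T, ρ D (w μ) - (c * 2 ^ μ ()) • w μ = 0 := by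
      intro μ hμ
      refine (Submodule.mem_bot ℂ).1 (vector_coeff_mem ⊥ T
        (fun μ => ρ D (w μ) - (c * 2 ^ μ ()) • w μ) (fun t _ => ?_) μ hμ)
      rw [Submodule.mem_bot]
      simp only [smul_sub, Finset.sum_sub_distrib]
      have h1 : ρ D (ρ (β (t ())) v) = c • ρ (β (2 * t ())) v := by
        rw [← Module.End.mul_apply, ← map_mul, hβD, map_mul, Module.End.mul_apply, hvc, map_smul]
      have h2 := hw (fun _ => 2 * t ())
      have h3 := hw t
      rw [h2, h3, map_sum, Finset.smul_sum] at h1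
      simp only [map_smul] at h1
      rw [h1, sub_eq_zero]
      refine Finset.sum_congr rfl fun μ _ => ?_
      rw [smul_smul, smul_smul]
      congr 1
      rw [Finsupp.prod_fintype _ _ (by simp), Finsupp.prod_fintype _ _ (by simp)]
      simp [mul_pow]
      ring
    have hw0 : ∀ μ ∈ T, μ ≠ 0 → w μ = 0 := by
      intro μ hμ h0
      by_contra hne
      have hmem : c * 2 ^ μ () ∈ S := ⟨w μ, hwW μ hμ, hne, sub_eq_zero.1 (hwD μ hμ)⟩
      have := hmax _ hmem
      have hk : μ () ≠ 0 := fun h => h0 (Finsupp.ext fun _ => h)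
      have h2 : (1 : ℝ) < 2 ^ μ () := one_lt_pow₀ (by norm_num) hk
      have hcp : 0 < ‖c‖ := norm_pos_iff.2 hc0
      simp only [norm_mul, norm_pow, Complex.norm_ofNat] at this
      nlinarith
    have e1 := hw fun _ => 1
    have e0 := hw fun _ => 0
    simp only [hβ1, hβ0] at e1 e0
    rw [e1, e0]
    refine Finset.sum_congr rfl fun μ hμ => ?_
    by_cases h0 : μ = 0
    · simp [h0]
    · rw [hw0 μ hμ h0, smul_zero, smul_zero]
  -- Under the full diagonal torus `v₀` splits into weight vectors that remain in `W` and in the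
  -- `c`-eigenspace of `D`; they sum to `v₀`, so one is nonzero.
  let W' : Submodule ℂ E := W ⊓ Module.End.eigenspace (ρ D) c
  obtain ⟨T, w, hw⟩ := exists_vector_coeff (σ := Fin n) (F := fun t => ρ (diagonal t) v₀)
    fun φ => mem_polyFun_of_forall_entry (hρ φ v₀) fun i j => by
      by_cases hij : i = j
      · subst hij
        simpa using linear_mem_polyFun (LinearMap.proj (R := ℂ) (φ := fun _ : Fin n => ℂ) i)
      · simpa [Matrix.diagonal_apply_ne _ hij] using const_mem_polyFun (X := Fin n → ℂ) 0
  have hwW := vector_coeff_mem W' T w fun t _ => by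
    rw [← hw]
    refine ⟨hW _ _ hv₀W, Module.End.mem_eigenspace_iff.2 ?_⟩
    rw [← Module.End.mul_apply, ← map_mul, Matrix.diagonal_mul_diagonal, ← map_smul, ← hv₀c,
      ← Module.End.mul_apply, ← map_mul, Matrix.diagonal_mul_diagonal]
    simp only [mul_comm]
  have hwt : ∀ μ ∈ T, ∀ s, ρ (diagonal s) (w μ) = (μ.prod fun i k => s i ^ k) • w μ := by
    intro μ hμ s
    refine sub_eq_zero.1 ((Submodule.mem_bot ℂ).1 (vector_coeff_mem ⊥ T
        (fun μ => ρ (diagonal s) (w μ) - (μ.prod fun i k => s i ^ k) • w μ) (fun t _ => ?_) μ hμ))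
    rw [Submodule.mem_bot]
    simp only [smul_sub, Finset.sum_sub_distrib]
    have h1 : ρ (diagonal s) (ρ (diagonal t) v₀) = ρ (diagonal fun i => s i * t i) v₀ := by
      rw [← Module.End.mul_apply, ← map_mul, Matrix.diagonal_mul_diagonal]
    have h2 := hw t
    have h3 := hw fun i => s i * t i
    rw [h2, h3, map_sum] at h1
    simp only [map_smul] at h1
    rw [h1, sub_eq_zero]
    refine Finset.sum_congr rfl fun μ _ => ?_
    rw [smul_smul]
    simp only [mul_pow, Finsupp.prod_mul, mul_comm]
  have hsum := hw 1
  obtain ⟨μ, hμ, hμ0⟩ : ∃ μ ∈ T, w μ ≠ 0 := by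
    by_contra! h
    refine hv₀ ?_
    have h1 : (diagonal (1 : Fin n → ℂ)) = 1 := Matrix.diagonal_one
    rw [h1, map_one] at hsum
    rw [← Module.End.one_apply (R := ℂ) v₀, hsum]
    exact Finset.sum_eq_zero fun μ hμ => by rw [h μ hμ, smul_zero]
  refine ⟨μ, w μ, (hwW μ hμ).1, hμ0, fun b hb => ?_⟩
  rw [key (w μ) (hwW μ hμ).1 (Module.End.mem_eigenspace_iff.1 (hwW μ hμ).2) b hb, hwt μ hμ,
    Finsupp.prod_fintype _ _ (by simp)]

/-- A proper subspace has a non-zero vector orthogonal to it. -/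
theorem exists_orthogonal_ne_zero [FiniteDimensional ℂ E] (B : E →ₗ⋆[ℂ] E →ₗ[ℂ] ℂ)
    {W : Submodule ℂ E} (hW : W ≠ ⊤) : ∃ v, v ≠ 0 ∧ ∀ w ∈ W, B w v = 0 := by
  let b := Module.finBasis ℂ W
  let f : E →ₗ[ℂ] (Fin (Module.finrank ℂ W) → ℂ) := LinearMap.pi fun i => B (b i)
  have hlt : Module.finrank ℂ (Fin (Module.finrank ℂ W) → ℂ) < Module.finrank ℂ E := by
    simpa using Submodule.finrank_lt (lt_top_iff_ne_top.2 hW).ne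
  obtain ⟨v, hv, hv0⟩ := (Submodule.ne_bot_iff _).1 (LinearMap.ker_ne_bot_of_finrank_lt hlt (f := f))
  refine ⟨v, hv0, fun w hw => ?_⟩
  have hi : ∀ i, B (b i) v = 0 := fun i => congrFun hv i
  have := congrArg Subtype.val (b.sum_repr ⟨w, hw⟩)
  simp only [Submodule.coe_sum, Submodule.coe_smul] at this
  rw [← this, map_sum, LinearMap.sum_apply]
  exact Finset.sum_eq_zero fun i _ => by simp [hi]

end PolynomialRepresentation

/-! ### Dominance of weights. -/

section Weights

variable {n : ℕ} {E : Type*} [AddCommGroup E] [Module ℂ E]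
  {ρ : Representation ℂ (Matrix (Fin n) (Fin n) ℂ) E}

theorem prod_zpow_eq_zpow_sum {ι : Type*} {z : ℂ} (hz : z ≠ 0) (s : Finset ι) (f : ι → ℤ) :
    ∏ i ∈ s, z ^ f i = z ^ ∑ i ∈ s, f i := by
  classical
  induction s using Finset.induction_on with
  | empty => simp
  | insert a s ha ih => rw [Finset.prod_insert ha, Finset.sum_insert ha, ih, zpow_add₀ hz]

theorem eq_of_forall_circle_zpow {a b : ℤ} (h : ∀ z : Circle, (z : ℂ) ^ a = (z : ℂ) ^ b) :
    a = b := by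
  by_contra hab
  have hk : ((a - b : ℤ) : ℝ) ≠ 0 := by exact_mod_cast sub_ne_zero.2 hab
  -- Here `z ^ (a - b) = exp (iπ) = -1`, whereas the hypothesis gives `1`.
  have h1 := h (Circle.exp (Real.pi / (a - b : ℤ)))
  rw [← Circle.coe_zpow, ← Circle.coe_zpow, Circle.coe_inj, ← mul_inv_eq_one, ← _root_.zpow_neg,
    ← _root_.zpow_add, ← sub_eq_add_neg, ← Circle.exp_zsmul, zsmul_eq_mul, mul_div_cancel₀ _ hk] at h1
  have h2 := congrArg (fun z : Circle => (z : ℂ)) h1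
  norm_num at h2

theorem IsHighest.diagonal {ν : Fin n → ℕ} {h : E} (hh : IsHighest ρ ν h) (t : Fin n → ℂ) :
    ρ (Matrix.diagonal t) h = (∏ i, t i ^ ν i) • h := by
  rw [hh _ fun i j hij => Matrix.diagonal_apply_ne _ hij.ne']
  simp

/-- The module generated by a highest weight vector is generated by the action of the lower
triangular matrices. -/
theorem IsPolynomialRep.mem_span_lower (hρ : IsPolynomialRep ρ) {ν : Fin n → ℕ} {h : E}
    (hh : IsHighest ρ ν h) (a : Matrix (Fin n) (Fin n) ℂ) :
    ρ a h ∈ Submodule.span ℂ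
      {e | ∃ L : Matrix (Fin n) (Fin n) ℂ, (∀ i j, i < j → L i j = 0) ∧ e = ρ L h} := by
  by_contra hn
  obtain ⟨φ, hφ, hker⟩ := Submodule.exists_le_ker_of_notMem hn
  refine hφ (eq_zero_of_lower_mul_upper (hρ φ h) (fun L U hL hU _ => ?_) a)
  have : φ (ρ L h) = 0 := hker (Submodule.subset_span ⟨L, hL, rfl⟩)
  simp only [map_mul, Module.End.mul_apply, hh U hU, map_smul, this, smul_zero]

/-- The weights of a module generated by a highest weight vector are dominated by the highest
weight. -/
theorem IsPolynomialRep.dominanceLE (hρ : IsPolynomialRep ρ) {ν : Fin n → ℕ} {h : E}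
    (hh : IsHighest ρ ν h) {e : E} (he : e ∈ Submodule.span ℂ (Set.range fun a => ρ a h))
    (he0 : e ≠ 0) {μ : Fin n → ℤ}
    (hμ : ∀ t : Fin n → Circle, ρ (diagonal fun i => (t i : ℂ)) e = (∏ r, (t r : ℂ) ^ μ r) • e) :
    DominanceLE μ fun i => ν i := by
  obtain ⟨φ, hφ⟩ : ∃ φ : E →ₗ[ℂ] ℂ, φ e ≠ 0 := by
    obtain ⟨φ, hφ, -⟩ := Submodule.exists_le_ker_of_notMem (p := (⊥ : Submodule ℂ E)) (v := e)
      (by simpa using he0)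
    exact ⟨φ, hφ⟩
  refine ⟨?_, fun r => ?_⟩
  · have hsc : ∀ z : ℂ, ∀ e ∈ Submodule.span ℂ (Set.range fun a => ρ a h),
        ρ (Matrix.diagonal fun _ => z) e = z ^ (∑ i, ν i) • e := fun z e he => by
      induction he using Submodule.span_induction with
      | mem x hx =>
        obtain ⟨a, rfl⟩ := hx
        have : (Matrix.diagonal fun _ : Fin n => z) * a = a * Matrix.diagonal fun _ => z := by
          ext i j
          simp [mul_comm]
        rw [← Module.End.mul_apply, ← map_mul, this, map_mul, Module.End.mul_apply, hh.diagonal,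
          map_smul, Finset.prod_pow_eq_pow_sum]
      | zero => simp
      | add x y _ _ hx hy => rw [map_add, hx, hy, smul_add]
      | smul c x _ hx => rw [map_smul, hx, smul_comm]
    have hz : ∑ i, μ i = ((∑ i, ν i : ℕ) : ℤ) := eq_of_forall_circle_zpow fun z => by
      have h1 := hμ fun _ => z
      rw [hsc z e he, prod_zpow_eq_zpow_sum (Circle.coe_ne_zero z)] at h1
      rw [zpow_natCast]
      exact (smul_left_injective ℂ he0 h1).symm
    rw [hz]
    push_cast
    rfl
  -- Moving the torus element past a lower triangular `L` changes only the entries below the block,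
  -- by a factor `τ`; on `h` it leaves a negative power that `τ ^ (∑ ν)` cancels. Hence the product
  -- is polynomial in `τ`.
  · have hQ : ∀ e ∈ Submodule.span ℂ (Set.range fun a => ρ a h), ∃ q ∈ polyFun ℂ, ∀ τ : ℂ, τ ≠ 0 →
        φ (ρ (Matrix.diagonal fun s => if s ≤ r then τ⁻¹ else 1) e) *
          τ ^ (∑ s ∈ Finset.univ.filter (· ≤ r), ν s) = q τ := by
      intro e he
      replace he := Submodule.span_le.2 (by
        rintro _ ⟨a, rfl⟩
        exact hρ.mem_span_lower hh a) he
      induction he using Submodule.span_induction with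
      | mem x hx =>
        obtain ⟨L, hL, rfl⟩ := hx
        let Lτ : ℂ → Matrix (Fin n) (Fin n) ℂ := fun τ => Matrix.of fun i j =>
          if j ≤ r ∧ r < i then τ * L i j else L i j
        refine ⟨fun τ => φ (ρ (Lτ τ) h), mem_polyFun_of_forall_entry (hρ φ h) fun i j => ?_,
          fun τ hτ => ?_⟩
        · by_cases hij : j ≤ r ∧ r < i
          · simp only [Lτ, Matrix.of_apply, hij, and_self, if_true]
            exact mul_mem (linear_mem_polyFun LinearMap.id) (const_mem_polyFun _)
          · simp only [Lτ, Matrix.of_apply, hij, if_false]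
            exact const_mem_polyFun _
        · have h1 : ρ (Matrix.diagonal fun s => if s ≤ r then τ else 1) h =
              τ ^ (∑ s ∈ Finset.univ.filter (· ≤ r), ν s) • h := by
            rw [hh.diagonal]
            congr 1
            rw [← Finset.prod_pow_eq_pow_sum, Finset.prod_filter]
            exact Finset.prod_congr rfl fun s _ => by split_ifs <;> simp
          rw [mul_comm, ← smul_eq_mul, ← map_smul, ← map_smul, ← map_smul, ← h1]
          simp only [← Module.End.mul_apply, ← map_mul]
          congr 3
          ext i j
          rw [← mul_assoc, Matrix.mul_diagonal, Matrix.diagonal_mul]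
          simp only [Lτ, Matrix.of_apply]
          rcases lt_or_ge i j with hij | hij
          · simp [hL i j hij]
          · by_cases hj : j ≤ r <;> by_cases hi : i ≤ r
            · simp [hj, hi, not_lt.2 hi, mul_comm, hτ]
            · simp [hj, hi, not_le.1 hi, mul_comm]
            · exact absurd (hij.trans hi) hj
            · simp [hj, hi]
      | zero => exact ⟨fun _ => 0, const_mem_polyFun _, by simp⟩
      | add x y _ _ hx hy =>
        obtain ⟨q, hq, hq'⟩ := hx
        obtain ⟨p, hp, hp'⟩ := hy
        exact ⟨q + p, add_mem hq hp, fun τ hτ => by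
          rw [Pi.add_apply, ← hq' τ hτ, ← hp' τ hτ, map_add, map_add, add_mul]⟩
      | smul c x _ hx =>
        obtain ⟨q, hq, hq'⟩ := hx
        exact ⟨c • q, Subalgebra.smul_mem _ hq c, fun τ hτ => by
          rw [Pi.smul_apply, ← hq' τ hτ, map_smul, map_smul, smul_mul_assoc]⟩
    obtain ⟨q, hq, hq'⟩ := hQ e he
    by_contra! hlt
    obtain ⟨d, hd⟩ := Int.eq_ofNat_of_zero_le (sub_nonneg.2 (Int.add_one_le_iff.2 hlt))
    -- If the partial sum of `μ` exceeds that of `ν` by `d + 1`, then `q z * z ^ (d + 1) = φ e` on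
    -- the circle, hence everywhere; at `z = 0` this contradicts `φ e ≠ 0`.
    have hcirc : ∀ z ∈ {z : ℂ | ‖z‖ = 1}, q z * z ^ (d + 1) - φ e = 0 := by
      intro z hz
      have hz0 : z ≠ 0 := fun h => by
        rw [Set.mem_ofPred_eq, h, norm_zero] at hz
        exact zero_ne_one hz
      let τ : Circle := ⟨z, mem_sphere_zero_iff_norm.2 hz⟩
      have h1 := hμ fun s => if s ≤ r then τ⁻¹ else 1
      have h2 : (∏ s, (((if s ≤ r then τ⁻¹ else 1 : Circle)) : ℂ) ^ μ s) =
          z⁻¹ ^ (∑ s ∈ Finset.univ.filter (· ≤ r), μ s) := by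
        rw [← prod_zpow_eq_zpow_sum (inv_ne_zero hz0), Finset.prod_filter]
        refine Finset.prod_congr rfl fun s _ => ?_
        split_ifs
        · rw [Circle.coe_inv]
        · simp
      have h3 : (fun s => (((if s ≤ r then τ⁻¹ else 1 : Circle)) : ℂ)) =
          fun s => if s ≤ r then z⁻¹ else 1 := by
        funext s
        split_ifs
        · rw [Circle.coe_inv]
        · simp
      rw [h2, h3] at h1
      rw [← hq' z hz0, h1, map_smul, smul_eq_mul, sub_eq_zero, _root_.inv_zpow', ← zpow_natCast,
        ← zpow_natCast]
      have h4 : z ^ (-∑ s ∈ Finset.univ.filter (· ≤ r), μ s) *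
          (z ^ ((∑ s ∈ Finset.univ.filter (· ≤ r), ν s : ℕ) : ℤ) * z ^ ((d + 1 : ℕ) : ℤ)) = 1 := by
        rw [← zpow_add₀ hz0, ← zpow_add₀ hz0, ← zpow_zero z]
        congr 1
        push_cast
        linarith
      linear_combination φ e * h4
    have := eq_zero_of_infinite_zeros (f := fun z => q z * z ^ (d + 1) - φ e)
      (sub_mem (mul_mem hq (pow_mem (linear_mem_polyFun LinearMap.id) _)) (const_mem_polyFun _))
      infinite_circle hcirc 0
    simp at this
    exact hφ this

/-- Highest weights are dominant. -/
theorem IsPolynomialRep.antitone (hρ : IsPolynomialRep ρ) {ν : Fin n → ℕ} {h : E}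
    (hh : IsHighest ρ ν h) (h0 : h ≠ 0) : Antitone ν := by
  intro i j hij
  rcases hij.eq_or_lt with rfl | hij
  · exact le_rfl
  let σ := Equiv.swap i j
  -- `P` moves `h` to weight `ν ∘ σ`. Up to index `i` the two weights differ only at `i`, so
  -- dominance of that partial sum reads `ν j ≤ ν i`.
  let P : Matrix (Fin n) (Fin n) ℂ := Matrix.of fun a b => if σ a = b then 1 else 0
  have hPP : P * P = 1 := by
    ext a b
    simp only [P, Matrix.mul_apply, Matrix.one_apply, Matrix.of_apply, ite_mul, one_mul, zero_mul]
    rw [Finset.sum_ite_eq]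
    simp [σ]
  have hP : ∀ t : Fin n → ℂ, Matrix.diagonal t * P = P * Matrix.diagonal fun a => t (σ a) := by
    intro t
    ext a b
    rw [Matrix.diagonal_mul, Matrix.mul_diagonal]
    by_cases hab : σ a = b
    · subst hab
      simp [P, σ]
    · simp [P, hab]
  have he0 : ρ P h ≠ 0 := fun h1 => h0 (by
    rw [← Module.End.one_apply (R := ℂ) h, ← map_one ρ, ← hPP, map_mul, Module.End.mul_apply, h1,
      map_zero])
  have hdom := hρ.dominanceLE hh (Submodule.subset_span ⟨P, rfl⟩) he0 (μ := fun a => ν (σ a))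
    fun t => by
      rw [← Module.End.mul_apply, ← map_mul, hP, map_mul, Module.End.mul_apply, hh.diagonal,
        map_smul]
      congr 1
      rw [← Equiv.prod_comp σ]
      simp [σ]
  have h1 := hdom.2 i
  rw [← Finset.add_sum_erase _ _ (show i ∈ Finset.univ.filter (· ≤ i) by simp),
    ← Finset.add_sum_erase _ (fun s => (ν s : ℤ)) (show i ∈ Finset.univ.filter (· ≤ i) by simp),
    Finset.sum_congr rfl (g := fun s => (ν s : ℤ))] at h1
  · have h2 := le_of_add_le_add_right h1
    simpa [σ] using h2
  · intro s hs
    simp only [Finset.mem_erase, Finset.mem_filter, Finset.mem_univ, true_and] at hs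
    rw [Equiv.swap_apply_of_ne_of_ne hs.1 (hs.2.trans_lt hij).ne]

end Weights

/-! ### Leading minors under triangular multiplication. -/

section Minors

variable {n : ℕ}

theorem prod_castLE_eq (g : Fin n → ℂ) (r : Fin n) :
    ∏ s : Fin ((r : ℕ) + 1), g (Fin.castLE (Nat.succ_le_of_lt r.isLt) s) =
      ∏ s ∈ Finset.univ.filter (· ≤ r), g s := by
  refine (Finset.prod_map Finset.univ (Fin.castLEEmb (Nat.succ_le_of_lt r.isLt)) g).symm.trans ?_
  congr 1
  ext s
  simp only [Finset.mem_map, Finset.mem_univ, true_and, Finset.mem_filter]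
  constructor
  · rintro ⟨a, rfl⟩
    exact Nat.lt_succ_iff.1 a.isLt
  · intro hs
    exact ⟨⟨s, Nat.lt_succ_iff.2 hs⟩, rfl⟩

/-- The first `r + 1` rows of `L * x` involve only those of `x`, so the leading block of the product
is the product of the leading blocks. -/
theorem leadingMinor_lower_mul {L : Matrix (Fin n) (Fin n) ℂ} (hL : ∀ i j, i < j → L i j = 0)
    (x : Matrix (Fin n) (Fin n) ℂ) (r : Fin n) :
    leadingMinor (L * x) r = (∏ s ∈ Finset.univ.filter (· ≤ r), L s s) * leadingMinor x r := by
  unfold leadingMinor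
  set e := Fin.castLE (Nat.succ_le_of_lt r.isLt) with he
  have hmul : (L * x).submatrix e e = L.submatrix e e * x.submatrix e e := by
    ext a b
    simp only [Matrix.submatrix_apply, Matrix.mul_apply]
    refine Eq.trans ?_ (Finset.sum_map Finset.univ (Fin.castLEEmb (Nat.succ_le_of_lt r.isLt))
      fun s => L (e a) s * x s (e b))
    refine (Finset.sum_subset (Finset.subset_univ _) fun s _ hs => ?_).symm
    rw [hL, zero_mul]
    by_contra hlt
    refine hs (Finset.mem_map.2 ⟨⟨s, ?_⟩, Finset.mem_univ _, rfl⟩)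
    exact lt_of_le_of_lt (Fin.le_def.1 (not_lt.1 hlt)) a.isLt
  rw [hmul, Matrix.det_mul, Matrix.det_of_isLowerTriangular, ← prod_castLE_eq (fun s => L s s)]
  · rfl
  · intro a b hab
    exact hL _ _ hab

theorem leadingMinor_transpose (x : Matrix (Fin n) (Fin n) ℂ) (r : Fin n) :
    leadingMinor xᵀ r = leadingMinor x r := by
  rw [leadingMinor, ← Matrix.transpose_submatrix, Matrix.det_transpose, leadingMinor]

theorem leadingMinor_mul_upper {b : Matrix (Fin n) (Fin n) ℂ} (hb : ∀ i j, j < i → b i j = 0)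
    (x : Matrix (Fin n) (Fin n) ℂ) (r : Fin n) :
    leadingMinor (x * b) r = (∏ s ∈ Finset.univ.filter (· ≤ r), b s s) * leadingMinor x r := by
  rw [← leadingMinor_transpose, Matrix.transpose_mul,
    leadingMinor_lower_mul (L := bᵀ) (fun i j hij => hb j i hij), leadingMinor_transpose]
  rfl

theorem leadingMinor_mem_polyFun (r : Fin n) :
    (fun x : Matrix (Fin n) (Fin n) ℂ => leadingMinor x r) ∈ polyFun _ := by
  simp only [leadingMinor, Matrix.det_apply]
  have : (fun x : Matrix (Fin n) (Fin n) ℂ => ∑ σ : Equiv.Perm (Fin ((r : ℕ) + 1)),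
      Equiv.Perm.sign σ • ∏ i, x.submatrix (Fin.castLE (Nat.succ_le_of_lt r.isLt))
        (Fin.castLE (Nat.succ_le_of_lt r.isLt)) (σ i) i) =
      ∑ σ : Equiv.Perm (Fin ((r : ℕ) + 1)), ((Equiv.Perm.sign σ : ℤ) : ℂ) •
        ∏ i, fun x : Matrix (Fin n) (Fin n) ℂ => x (Fin.castLE (Nat.succ_le_of_lt r.isLt) (σ i))
          (Fin.castLE (Nat.succ_le_of_lt r.isLt) i) := by
    funext x
    simp [Units.smul_def]
  rw [this]
  exact sum_mem fun σ _ => Subalgebra.smul_mem _ (prod_mem fun i _ => entry_mem_polyFun _ _) _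

/-- The exponent `ν_r - ν_{r + 1}` of the `r`-th leading minor. -/
def gap (ν : Fin n → ℕ) (r : Fin n) : ℕ := ν r - if h : (r : ℕ) + 1 < n then ν ⟨(r : ℕ) + 1, h⟩ else 0

/-- A telescoping sum, with `ν` extended by zero; monotonicity keeps the truncated subtractions
exact. -/
theorem sum_gap {ν : Fin n → ℕ} (hν : Antitone ν) (s : Fin n) :
    ∑ r ∈ Finset.univ.filter (s ≤ ·), gap ν r = ν s := by
  let N : ℕ → ℕ := fun k => if h : k < n then ν ⟨k, h⟩ else 0
  have hN : ∀ k, N (k + 1) ≤ N k := fun k => by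
    by_cases h : k + 1 < n
    · simp only [N, h, dif_pos, (Nat.lt_succ_self k).trans h]
      exact hν (Nat.le_succ k)
    · simp [N, h]
  have hgap : ∀ r : Fin n, gap ν r = N r - N (r + 1) := fun r => by simp [gap, N]
  have key : ∀ j, ∑ k ∈ Finset.range j, (N (s + k) - N (s + k + 1)) + N (s + j) = N s := by
    intro j
    induction j with
    | zero => simp
    | succ j ih =>
      rw [Finset.sum_range_succ]
      have h1 := hN (s + j)
      have h2 : N (s + (j + 1)) = N (s + j + 1) := rfl
      omega
  have h1 := key (n - s)
  have h2 : N (s + (n - s)) = 0 := by simp [N]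
  rw [h2, add_zero] at h1
  have h3 : N s = ν s := by simp [N]
  rw [← h3, ← h1]
  simp_rw [hgap]
  symm
  refine Finset.sum_bij (fun k hk => ⟨s + k, by have := Finset.mem_range.1 hk; omega⟩)
    (fun k _ => Finset.mem_filter.2 ⟨Finset.mem_univ _, Fin.le_def.2 (Nat.le_add_right _ _)⟩)
    (fun a _ b _ h => Nat.add_left_cancel (Fin.mk.inj h)) (fun r hr => ?_)
    (fun k _ => rfl)
  simp only [Finset.mem_filter, Finset.mem_univ, true_and, Fin.le_def] at hr
  exact ⟨(r : ℕ) - s, Finset.mem_range.2 (by omega), Fin.ext (by simp only; omega)⟩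

theorem prod_prod_pow_gap {ν : Fin n → ℕ} (hν : Antitone ν) (g : Fin n → ℂ) :
    ∏ r, (∏ s ∈ Finset.univ.filter (· ≤ r), g s) ^ gap ν r = ∏ s, g s ^ ν s := by
  simp_rw [← Finset.prod_pow, Finset.prod_filter]
  rw [Finset.prod_comm]
  refine Finset.prod_congr rfl fun s _ => ?_
  rw [← sum_gap hν s, ← Finset.prod_pow_eq_pow_sum, Finset.prod_filter]

/-- The product of powers of leading minors that generates the representation of highest weight
`ν`, as a polynomial function on all matrices. -/
def minorProduct (ν : Fin n → ℕ) (x : Matrix (Fin n) (Fin n) ℂ) : ℂ :=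
  ∏ r, leadingMinor x r ^ gap ν r

theorem minorProduct_lower_mul {ν : Fin n → ℕ} (hν : Antitone ν) {L : Matrix (Fin n) (Fin n) ℂ}
    (hL : ∀ i j, i < j → L i j = 0) (x : Matrix (Fin n) (Fin n) ℂ) :
    minorProduct ν (L * x) = (∏ i, L i i ^ ν i) * minorProduct ν x := by
  simp only [minorProduct, leadingMinor_lower_mul hL, mul_pow, Finset.prod_mul_distrib,
    prod_prod_pow_gap hν fun s => L s s]

theorem minorProduct_mul_upper {ν : Fin n → ℕ} (hν : Antitone ν) {b : Matrix (Fin n) (Fin n) ℂ}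
    (hb : ∀ i j, j < i → b i j = 0) (x : Matrix (Fin n) (Fin n) ℂ) :
    minorProduct ν (x * b) = (∏ i, b i i ^ ν i) * minorProduct ν x := by
  simp only [minorProduct, leadingMinor_mul_upper hb, mul_pow, Finset.prod_mul_distrib,
    prod_prod_pow_gap hν fun s => b s s]

theorem minorProduct_one (ν : Fin n → ℕ) : minorProduct ν 1 = 1 := by
  refine Finset.prod_eq_one fun r _ => ?_
  rw [leadingMinor, Matrix.submatrix_one _ (Fin.castLE_injective _), Matrix.det_one, one_pow]

theorem minorProduct_mem_polyFun (ν : Fin n → ℕ) :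
    minorProduct ν ∈ polyFun (Matrix (Fin n) (Fin n) ℂ) := by
  have : minorProduct ν =
      ∏ r, (fun x : Matrix (Fin n) (Fin n) ℂ => leadingMinor x r) ^ gap ν r := by
    funext x
    simp [minorProduct]
  rw [this]
  exact prod_mem fun r _ => pow_mem (leadingMinor_mem_polyFun r) _

end Minors

/-! ### Irreducible modules of equivariant polynomials. -/

section Equivariant

variable {n : ℕ}

/-- The polynomial functions `f` on matrices with `f (L x) = (∏ i, L i i ^ ν i) f x` for all lower
triangular `L`. -/
def eqvFun (ν : Fin n → ℕ) : Submodule ℂ (Matrix (Fin n) (Fin n) ℂ → ℂ) where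
  carrier := {f | f ∈ polyFun _ ∧ ∀ L : Matrix (Fin n) (Fin n) ℂ, (∀ i j, i < j → L i j = 0) →
    ∀ x, f (L * x) = (∏ i, L i i ^ ν i) * f x}
  add_mem' hf hg := ⟨add_mem hf.1 hg.1, fun L hL x => by
    rw [Pi.add_apply, Pi.add_apply, hf.2 L hL, hg.2 L hL, mul_add]⟩
  zero_mem' := ⟨zero_mem _, fun L _ x => by simp⟩
  smul_mem' c f hf := ⟨Subalgebra.smul_mem _ hf.1 c, fun L hL x => by
    rw [Pi.smul_apply, Pi.smul_apply, hf.2 L hL, smul_eq_mul, smul_eq_mul, mul_left_comm]⟩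

/-- Equivariance under scalar matrices forces homogeneity of degree `∑ i, ν i`. -/
instance (ν : Fin n → ℕ) : FiniteDimensional ℂ (eqvFun ν) := by
  let d := ∑ i, ν i
  let ev : MvPolynomial (Fin n × Fin n) ℂ →ₗ[ℂ] (Matrix (Fin n) (Fin n) ℂ → ℂ) :=
    LinearMap.pi fun x => (MvPolynomial.aeval fun ij : Fin n × Fin n => x ij.1 ij.2).toLinearMap
  have hev : ∀ p x, ev p x = MvPolynomial.eval (fun ij : Fin n × Fin n => x ij.1 ij.2) p :=
    fun p x => by simp [ev]
  refine Submodule.finiteDimensional_of_le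
    (S₂ := (MvPolynomial.restrictTotalDegree (Fin n × Fin n) ℂ d).map ev) fun f hf => ?_
  let φ : (Fin n × Fin n → ℂ) →ₗ[ℂ] Matrix (Fin n) (Fin n) ℂ :=
    { toFun := fun t => Matrix.of fun i j => t (i, j)
      map_add' := fun _ _ => rfl
      map_smul' := fun _ _ => rfl }
  obtain ⟨p, hp⟩ := exists_mvPolynomial (polyFun_comp_linear hf.1 φ)
  have hp' : ∀ x, f x = MvPolynomial.eval (fun ij : Fin n × Fin n => x ij.1 ij.2) p :=
    fun x => hp fun ij => x ij.1 ij.2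
  refine ⟨MvPolynomial.homogeneousComponent d p, ?_, ?_⟩
  · exact (MvPolynomial.mem_restrictTotalDegree _ _ _).2
      (MvPolynomial.homogeneousComponent_isHomogeneous d p).totalDegree_le
  · funext x
    let t : Fin n × Fin n → ℂ := fun ij => x ij.1 ij.2
    let Q : Polynomial ℂ := ∑ μ ∈ p.support,
      Polynomial.C (p.coeff μ * ∏ i, t i ^ μ i) * Polynomial.X ^ μ.degree
    have hQ : Q = Polynomial.C (f x) * Polynomial.X ^ d := by
      refine Polynomial.funext fun z => ?_
      have h1 := hf.2 (diagonal fun _ => z) (fun i j hij => diagonal_apply_ne _ hij.ne) x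
      simp only [diagonal_apply_eq, Finset.prod_pow_eq_pow_sum] at h1
      rw [hp', MvPolynomial.eval_eq'] at h1
      rw [Polynomial.eval_mul, Polynomial.eval_C, Polynomial.eval_pow, Polynomial.eval_X,
        mul_comm, ← h1, Polynomial.eval_finsetSum]
      refine Finset.sum_congr rfl fun μ _ => ?_
      simp only [Polynomial.eval_mul, Polynomial.eval_C, Polynomial.eval_pow, Polynomial.eval_X,
        Matrix.diagonal_mul, mul_pow, Finset.prod_mul_distrib, Finset.prod_pow_eq_pow_sum,
        Finsupp.degree_eq_sum, t]
      ring
    have h2 := congrArg (fun q => Polynomial.coeff q d) hQ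
    simp only [Polynomial.coeff_C_mul_X_pow, if_true, Q, Polynomial.finsetSum_coeff] at h2
    rw [← h2, hev, MvPolynomial.homogeneousComponent_apply, map_sum, Finset.sum_filter]
    refine Finset.sum_congr rfl fun μ _ => ?_
    by_cases h : μ.degree = d
    · rw [if_pos h, if_pos h.symm, MvPolynomial.eval_monomial,
        Finsupp.prod_fintype _ _ (by simp)]
    · rw [if_neg h, if_neg (Ne.symm h)]

/-- Right translation on `eqvFun ν`. -/
def eqvRep (ν : Fin n → ℕ) : Representation ℂ (Matrix (Fin n) (Fin n) ℂ) (eqvFun ν) where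
  toFun a :=
    { toFun := fun f => ⟨fun x => f.1 (x * a), mul_right_mem_polyFun f.2.1 a, fun L hL x =>
        (congrArg f.1 (Matrix.mul_assoc L x a)).trans (f.2.2 L hL (x * a))⟩
      map_add' := fun _ _ => rfl
      map_smul' := fun _ _ => rfl }
  map_one' := by ext f x; simp
  map_mul' a b := by ext f x; simp [Matrix.mul_assoc]

theorem eqvRep_apply (ν : Fin n → ℕ) (a x : Matrix (Fin n) (Fin n) ℂ) (f : eqvFun ν) :
    (eqvRep ν a f).1 x = f.1 (x * a) := rfl

/-- Only the zero function is killed by all evaluations. Polynomiality of matrix coefficients thus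
needs checking for evaluations alone. -/
theorem span_eval_eq_top {X : Type*} (V : Submodule ℂ (X → ℂ)) [FiniteDimensional ℂ V] :
    Submodule.span ℂ (Set.range fun x => (LinearMap.proj x).comp V.subtype) =
      (⊤ : Submodule ℂ (Module.Dual ℂ V)) := by
  rw [← Subspace.dualCoannihilator_dualAnnihilator_eq
    (W := Submodule.span ℂ (Set.range fun x => (LinearMap.proj x).comp V.subtype))]
  have : (Submodule.span ℂ (Set.range fun x =>
      (LinearMap.proj (R := ℂ) (φ := fun _ : X => ℂ) x).comp V.subtype)).dualCoannihilator = ⊥ := by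
    rw [eq_bot_iff]
    intro f hf
    rw [Submodule.mem_bot]
    ext x
    exact (Submodule.mem_dualCoannihilator _).1 hf _ (Submodule.subset_span ⟨x, rfl⟩)
  rw [this, Submodule.dualAnnihilator_bot]

theorem isPolynomialRep_eqvRep (ν : Fin n → ℕ) : IsPolynomialRep (eqvRep ν) := by
  intro φ f
  have hφ : φ ∈ Submodule.span ℂ
      (Set.range fun x => (LinearMap.proj x).comp (eqvFun ν).subtype) := by
    rw [span_eval_eq_top]
    trivial
  induction hφ using Submodule.span_induction with
  | mem ψ hψ =>
    obtain ⟨x, rfl⟩ := hψ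
    exact mul_left_mem_polyFun f.2.1 x
  | zero => exact const_mem_polyFun 0
  | add φ ψ _ _ hφ hψ => exact add_mem hφ hψ
  | smul c φ _ hφ => exact Subalgebra.smul_mem _ hφ c

/-- The highest weight vector of `eqvFun ν`. -/
def eqvTop {ν : Fin n → ℕ} (hν : Antitone ν) : eqvFun ν :=
  ⟨minorProduct ν, minorProduct_mem_polyFun ν, fun _ hL x => minorProduct_lower_mul hν hL x⟩

theorem isHighest_eqvTop {ν : Fin n → ℕ} (hν : Antitone ν) :
    IsHighest (eqvRep ν) ν (eqvTop hν) := fun b hb => by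
  ext x
  exact minorProduct_mul_upper hν hb x

theorem eqvTop_ne_zero {ν : Fin n → ℕ} (hν : Antitone ν) : eqvTop hν ≠ 0 := fun h => by
  have := congrArg (fun f : eqvFun ν => f.1 1) h
  exact one_ne_zero ((minorProduct_one ν).symm.trans this)

theorem eq_of_forall_prod_pow {μ ν : Fin n → ℕ}
    (h : ∀ t : Fin n → ℂ, ∏ i, t i ^ μ i = ∏ i, t i ^ ν i) : μ = ν := by
  funext i
  have h1 := h fun j => if j = i then 2 else 1
  have h2 : ∀ μ : Fin n → ℕ, ∏ j, (if j = i then (2 : ℂ) else 1) ^ μ j = 2 ^ μ i := fun μ => by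
    rw [Finset.prod_eq_single i (fun j _ hj => by simp [hj]) (by simp)]
    simp
  rw [h2, h2] at h1
  exact Nat.pow_right_injective le_rfl (by exact_mod_cast h1)

/-- The highest weight vectors of `eqvFun ν` are the multiples of `eqvTop`. -/
theorem eq_smul_eqvTop {ν μ : Fin n → ℕ} (hν : Antitone ν) {f : eqvFun ν}
    (hf : IsHighest (eqvRep ν) μ f) (hf0 : f ≠ 0) : μ = ν ∧ f.1 1 ≠ 0 ∧ f = f.1 1 • eqvTop hν := by
  have hU : ∀ L U : Matrix (Fin n) (Fin n) ℂ, (∀ i j, i < j → L i j = 0) →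
      (∀ i j, j < i → U i j = 0) →
      f.1 (L * U) = (∏ i, L i i ^ ν i) * ((∏ i, U i i ^ μ i) * f.1 1) := fun L U hL hU => by
    have h1 := congrArg (fun g : eqvFun ν => g.1 1) (hf U hU)
    simp only [eqvRep_apply, one_mul] at h1
    rw [f.2.2 L hL, h1]
    rfl
  have h1 : f.1 1 ≠ 0 := fun h => hf0 (by
    ext x
    exact eq_zero_of_lower_mul_upper f.2.1 (fun L U hL hU' _ => by rw [hU L U hL hU', h]; simp) x)
  -- A diagonal matrix is both lower and upper triangular, so `f (diagonal t)` can be computed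
  -- through either character.
  have hμ : μ = ν := eq_of_forall_prod_pow fun t => by
    have h2 := hU (diagonal t) 1 (fun i j hij => diagonal_apply_ne _ hij.ne)
      fun i j hij => one_apply_ne hij.ne'
    have h3 := hU 1 (diagonal t) (fun i j hij => one_apply_ne hij.ne)
      fun i j hij => diagonal_apply_ne _ hij.ne'
    rw [mul_one] at h2
    rw [one_mul, h2] at h3
    simp only [diagonal_apply_eq, one_apply_eq, one_pow, Finset.prod_const_one, one_mul] at h3
    exact (mul_right_cancel₀ h1 h3).symm
  refine ⟨hμ, h1, ?_⟩
  subst hμ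
  ext x
  refine sub_eq_zero.1 (eq_zero_of_lower_mul_upper
    (sub_mem f.2.1 (f.1 1 • eqvTop hν).2.1) (fun L U hL hU' _ => ?_) x)
  have h2 : (f.1 1 • eqvTop hν).1 (L * U) = f.1 1 * minorProduct μ (L * U) := rfl
  rw [Pi.sub_apply, hU L U hL hU', h2, minorProduct_lower_mul hν hL, ← one_mul U,
    minorProduct_mul_upper hν hU', minorProduct_one, one_mul]
  ring

/-- `eqvFun ν` is irreducible: a non-zero stable subspace is everything. -/
theorem eqvFun_irreducible {ν : Fin n → ℕ} (hν : Antitone ν) {W : Submodule ℂ (eqvFun ν)}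
    (hW : ∀ u : UGrp n, ∀ f ∈ W, eqvRep ν u f ∈ W) (h0 : W ≠ ⊥) : W = ⊤ := by
  have hρ := isPolynomialRep_eqvRep ν
  -- Highest weight vectors form one line, so each nonzero stable subspace contains `eqvTop`. A
  -- proper `W` and its orthogonal complement would both contain it, against definiteness.
  have htop : ∀ W : Submodule ℂ (eqvFun ν), (∀ a, ∀ f ∈ W, eqvRep ν a f ∈ W) → W ≠ ⊥ →
      eqvTop hν ∈ W := fun W hW h0 => by
    obtain ⟨μ, f, hf, hf0, hfμ⟩ := hρ.exists_isHighest hW h0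
    obtain ⟨-, h1, h2⟩ := eq_smul_eqvTop hν hfμ hf0
    rw [h2] at hf
    exact (W.smul_mem_iff h1).1 hf
  replace hW := hρ.stable_of_unitary hW
  obtain ⟨B, hB, hBa⟩ := hρ.exists_invariant_form
  by_contra hne
  obtain ⟨v, hv0, hv⟩ := exists_orthogonal_ne_zero B hne
  let W' : Submodule ℂ (eqvFun ν) := ⨅ w ∈ W, LinearMap.ker (B w)
  have hmem : ∀ f, f ∈ W' ↔ ∀ w ∈ W, B w f = 0 := fun f => by simp [W']
  have h1 := htop W' (fun a f hf => (hmem _).2 fun w hw => by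
    rw [hBa]
    exact (hmem f).1 hf _ (hW _ _ hw)) fun h => hv0 (by
      have := (hmem v).2 hv
      rwa [h, Submodule.mem_bot] at this)
  exact hB _ (eqvTop_ne_zero hν) ((hmem _).1 h1 _ (htop W hW h0))

theorem span_eqvTop {ν : Fin n → ℕ} (hν : Antitone ν) :
    Submodule.span ℂ (Set.range fun u : UGrp n => eqvRep ν u (eqvTop hν)) = ⊤ := by
  refine eqvFun_irreducible hν (fun u f hf => ?_) fun h => ?_
  · induction hf using Submodule.span_induction with
    | mem f hf =>
      obtain ⟨v, rfl⟩ := hf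
      refine Submodule.subset_span ⟨u * v, ?_⟩
      simp only [Submonoid.coe_mul, map_mul, Module.End.mul_apply]
    | zero => simp
    | add f g _ _ hf hg => rw [map_add]; exact add_mem hf hg
    | smul c f _ hf => rw [map_smul]; exact Submodule.smul_mem _ _ hf
  · have : eqvTop hν ∈ Submodule.span ℂ (Set.range fun u : UGrp n => eqvRep ν u (eqvTop hν)) :=
      Submodule.subset_span ⟨1, by simp⟩
    rw [h, Submodule.mem_bot] at this
    exact eqvTop_ne_zero hν this

end Equivariant

/-! ### Transport to `V(λ)` over `U(n)` and `SU(n)`. -/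

section Transport

variable {n : ℕ}

theorem unitary_det_ne_zero (u : UGrp n) : (u : Matrix (Fin n) (Fin n) ℂ).det ≠ 0 := by
  have h := congrArg Matrix.det (Matrix.mem_unitaryGroup_iff.1 u.2)
  rw [Matrix.det_mul, Matrix.det_one] at h
  exact left_ne_zero_of_mul_eq_one h

theorem leadingMinor_last (x : Matrix (Fin n) (Fin n) ℂ) (r : Fin n) (hr : ¬ (r : ℕ) + 1 < n) :
    leadingMinor x r = x.det := by
  have hn : (r : ℕ) + 1 = n := by omega
  rw [leadingMinor]
  exact Matrix.det_submatrix_equiv_self (finCongr hn) x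

/-- A common shift `c` cancels in all differences of consecutive entries and survives only in the
last exponent, that of the full determinant. -/
theorem highestWeightFun_eq {ν : Fin n → ℕ} (hν : Antitone ν) {c : ℤ} {lam : Fin n → ℤ}
    (hlam : ∀ r, lam r = ν r + c) (u : UGrp n) :
    highestWeightFun lam u = (u : Matrix (Fin n) (Fin n) ℂ).det ^ c * minorProduct ν u := by
  have hr : ∀ r : Fin n, leadingMinor (u : Matrix (Fin n) (Fin n) ℂ) r ^
      (lam r - if h : (r : ℕ) + 1 < n then lam ⟨(r : ℕ) + 1, h⟩ else 0) =
      (if (r : ℕ) + 1 < n then 1 else (u : Matrix (Fin n) (Fin n) ℂ).det ^ c) *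
        leadingMinor (u : Matrix (Fin n) (Fin n) ℂ) r ^ gap ν r := fun r => by
    by_cases h : (r : ℕ) + 1 < n
    · have h1 : ν ⟨(r : ℕ) + 1, h⟩ ≤ ν r := hν (Fin.le_def.2 (Nat.le_succ _))
      have h2 : (lam r - lam ⟨(r : ℕ) + 1, h⟩) = ((ν r - ν ⟨(r : ℕ) + 1, h⟩ : ℕ) : ℤ) := by
        rw [hlam, hlam, Nat.cast_sub h1]
        ring
      simp only [h, dif_pos, if_true, one_mul, gap]
      rw [h2, zpow_natCast]
    · simp only [h, dif_neg, if_false, gap, not_false_eq_true, sub_zero, Nat.sub_zero]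
      rw [leadingMinor_last _ r h, hlam, add_comm, zpow_add₀ (unitary_det_ne_zero u), zpow_natCast]
  rw [highestWeightFun, Finset.prod_congr rfl fun r _ => hr r, Finset.prod_mul_distrib]
  congr 1
  rcases n with _ | n
  · simp
  · rw [Finset.prod_eq_single (Fin.last n)]
    · simp
    · intro r _ hr
      have : (r : ℕ) + 1 < n + 1 := by
        have := Fin.val_lt_last hr
        omega
      rw [if_pos this]
    · simp

/-- Restriction to `U(n)` followed by multiplication by `det ^ c`. -/
def detTwist (ν : Fin n → ℕ) (c : ℤ) : eqvFun ν →ₗ[ℂ] (UGrp n → ℂ) where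
  toFun f u := (u : Matrix (Fin n) (Fin n) ℂ).det ^ c * f.1 u
  map_add' f g := by
    funext u
    exact mul_add _ _ _
  map_smul' a f := by
    funext u
    exact mul_left_comm _ _ _

theorem detTwist_apply (ν : Fin n → ℕ) (c : ℤ) (f : eqvFun ν) (u : UGrp n) :
    detTwist ν c f u = (u : Matrix (Fin n) (Fin n) ℂ).det ^ c * f.1 u := rfl

theorem detTwist_injective (ν : Fin n → ℕ) (c : ℤ) : Function.Injective (detTwist ν c) := by
  rw [← LinearMap.ker_eq_bot, LinearMap.ker_eq_bot']
  intro f hf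
  ext x
  exact eq_zero_of_unitary f.2.1 (fun u => (mul_eq_zero.1 (congrFun hf u)).resolve_left
    (zpow_ne_zero _ (unitary_det_ne_zero u))) x

theorem rightTranslation_detTwist (ν : Fin n → ℕ) (c : ℤ) (u : UGrp n) (f : eqvFun ν) :
    rightTranslation n u (detTwist ν c f) =
      (u : Matrix (Fin n) (Fin n) ℂ).det ^ c • detTwist ν c (eqvRep ν u f) := by
  funext x
  have h1 : rightTranslation n u (detTwist ν c f) x = detTwist ν c f (x * u) := rfl
  rw [h1, detTwist_apply, Submonoid.coe_mul, Matrix.det_mul, Pi.smul_apply, detTwist_apply,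
    eqvRep_apply, mul_zpow, smul_eq_mul]
  ring

theorem range_detTwist {ν : Fin n → ℕ} (hν : Antitone ν) {c : ℤ} {lam : Fin n → ℤ}
    (hlam : ∀ r, lam r = ν r + c) :
    LinearMap.range (detTwist ν c) = (spaceV lam).toSubmodule := by
  have htop : highestWeightFun lam = detTwist ν c (eqvTop hν) := by
    funext u
    exact highestWeightFun_eq hν hlam u
  have hs : (spaceV lam).toSubmodule =
      Submodule.span ℂ (Set.range fun u => rightTranslation n u (highestWeightFun lam)) := rfl
  rw [hs, htop, LinearMap.range_eq_map, ← span_eqvTop hν, Submodule.map_span]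
  refine le_antisymm (Submodule.span_le.2 ?_) (Submodule.span_le.2 ?_)
  · rintro _ ⟨_, ⟨u, rfl⟩, rfl⟩
    refine (Submodule.smul_mem_iff _ (zpow_ne_zero c (unitary_det_ne_zero u))).1 ?_
    rw [← rightTranslation_detTwist]
    exact Submodule.subset_span ⟨u, rfl⟩
  · rintro _ ⟨u, rfl⟩
    rw [SetLike.mem_coe]
    simp only [rightTranslation_detTwist]
    exact Submodule.smul_mem _ _ (Submodule.subset_span ⟨_, ⟨u, rfl⟩, rfl⟩)

/-- The space of `V_n(λ)` for `λ = ν + (c, …, c)` in terms of polynomial functions. -/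
def equivSpaceV {ν : Fin n → ℕ} (hν : Antitone ν) {c : ℤ} {lam : Fin n → ℤ}
    (hlam : ∀ r, lam r = ν r + c) : eqvFun ν ≃ₗ[ℂ] (spaceV lam).toSubmodule :=
  (LinearEquiv.ofInjective (detTwist ν c) (detTwist_injective ν c)).trans
    (LinearEquiv.ofEq _ _ (range_detTwist hν hlam))

theorem repVU_equivSpaceV {ν : Fin n → ℕ} (hν : Antitone ν) {c : ℤ} {lam : Fin n → ℤ}
    (hlam : ∀ r, lam r = ν r + c) (u : UGrp n) (f : eqvFun ν) :
    repVU lam u (equivSpaceV hν hlam f) =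
      (u : Matrix (Fin n) (Fin n) ℂ).det ^ c • equivSpaceV hν hlam (eqvRep ν u f) :=
  Subtype.ext (rightTranslation_detTwist ν c u f)

theorem repV_equivSpaceV {ν : Fin n → ℕ} (hν : Antitone ν) {c : ℤ} {lam : Fin n → ℤ}
    (hlam : ∀ r, lam r = ν r + c) (g : SUGrp n) (f : eqvFun ν) :
    repV lam g (equivSpaceV hν hlam f) = equivSpaceV hν hlam (eqvRep ν g.1 f) := by
  have h := repVU_equivSpaceV hν hlam
    (Submonoid.inclusion Matrix.specialUnitaryGroup_le_unitaryGroup g) f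
  have hdet : ((Submonoid.inclusion Matrix.specialUnitaryGroup_le_unitaryGroup g : UGrp n) :
      Matrix (Fin n) (Fin n) ℂ).det = 1 := (Matrix.mem_specialUnitaryGroup_iff.1 g.2).2
  rw [hdet, _root_.one_zpow, one_smul] at h
  exact h

/-- An `n`-th root of `det u` has modulus one, so dividing by it keeps `u` unitary. As scalar
matrices act on `eqvFun ν` by scalars, stability under `SU(n)` implies stability under `U(n)`. -/
theorem exists_eq_smul_specialUnitary (hn : 0 < n) (u : UGrp n) :
    ∃ (z : ℂ) (g : SUGrp n), (u : Matrix (Fin n) (Fin n) ℂ) = g.1 * diagonal fun _ => z := by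
  obtain ⟨z, hz⟩ := IsAlgClosed.exists_pow_nat_eq (u : Matrix (Fin n) (Fin n) ℂ).det hn
  have hz0 : z ≠ 0 := fun h => unitary_det_ne_zero u (by rw [← hz, h, zero_pow hn.ne'])
  have hnorm : ‖z‖ = 1 := by
    have h1 : (u : Matrix (Fin n) (Fin n) ℂ).det * star (u : Matrix (Fin n) (Fin n) ℂ).det = 1 := by
      have h := congrArg Matrix.det (Matrix.mem_unitaryGroup_iff.1 u.2)
      rwa [Matrix.det_mul, Matrix.det_one, Matrix.star_eq_conjTranspose,
        Matrix.det_conjTranspose] at h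
    have h2 := congrArg (fun w : ℂ => ‖w‖) h1
    simp only [norm_mul, norm_star, norm_one, ← hz, norm_pow] at h2
    exact (pow_eq_one_iff_of_nonneg (norm_nonneg z) (n := n + n) (by omega)).1 (by rw [pow_add, h2])
  have hconj : z * (starRingEnd ℂ) z = 1 := by
    rw [Complex.mul_conj, Complex.normSq_eq_norm_sq, hnorm]
    simp
  refine ⟨z, ⟨(u : Matrix (Fin n) (Fin n) ℂ) * diagonal fun _ => z⁻¹,
    Matrix.mem_specialUnitaryGroup_iff.2 ⟨mul_mem u.2 ?_, ?_⟩⟩, ?_⟩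
  · rw [Matrix.mem_unitaryGroup_iff, Matrix.star_eq_conjTranspose, Matrix.diagonal_conjTranspose,
      Matrix.diagonal_mul_diagonal, ← Matrix.diagonal_one]
    congr 1
    funext r
    simp [← mul_inv, hconj]
  · rw [Matrix.det_mul, Matrix.det_diagonal, Finset.prod_const, Finset.card_univ,
      Fintype.card_fin, inv_pow, hz, mul_inv_cancel₀ (unitary_det_ne_zero u)]
  · rw [Matrix.mul_assoc, Matrix.diagonal_mul_diagonal]
    simp [inv_mul_cancel₀ hz0]

theorem eqvRep_scalar (ν : Fin n → ℕ) (z : ℂ) (f : eqvFun ν) :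
    eqvRep ν (diagonal fun _ => z) f = z ^ (∑ i, ν i) • f := by
  ext x
  have h1 : x * (diagonal fun _ => z) = (diagonal fun _ => z) * x := by
    ext i j
    simp [mul_comm]
  have h2 := f.2.2 (diagonal fun _ => z) (fun i j hij => diagonal_apply_ne _ hij.ne) x
  simp only [diagonal_apply_eq, Finset.prod_pow_eq_pow_sum] at h2
  rw [eqvRep_apply, h1, h2]
  rfl

theorem exists_normal_form (hn : 0 < n) {lam : Fin n → ℤ} (hlam : Antitone lam) :
    ∃ (ν : Fin n → ℕ) (c : ℤ), Antitone ν ∧ ∀ r, lam r = ν r + c := by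
  have hlast : ∀ r : Fin n, lam ⟨n - 1, by omega⟩ ≤ lam r := fun r =>
    hlam (Fin.le_def.2 (by simp only; omega))
  refine ⟨fun r => (lam r - lam ⟨n - 1, by omega⟩).toNat, lam ⟨n - 1, by omega⟩,
    fun a b hab => Int.toNat_le_toNat (sub_le_sub_right (hlam hab) _), fun r => ?_⟩
  have := hlast r
  rw [Int.toNat_of_nonneg (by omega)]
  ring

/-- A subspace of `V_n(λ)` stable under `SU(n)` is trivial. -/
theorem eq_bot_or_top_of_stable (hn : 0 < n) {lam : Fin n → ℤ} (hlam : Antitone lam)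
    {W : Submodule ℂ (spaceV lam).toSubmodule} (hW : ∀ g, ∀ v ∈ W, repV lam g v ∈ W) :
    W = ⊥ ∨ W = ⊤ := by
  obtain ⟨ν, c, hν, hc⟩ := exists_normal_form hn hlam
  let Ψ := equivSpaceV hν hc
  by_cases hbot : W.comap Ψ.toLinearMap = ⊥
  · left
    rw [eq_bot_iff]
    intro v hv
    have : Ψ.symm v ∈ W.comap Ψ.toLinearMap := by simpa using hv
    rw [hbot, Submodule.mem_bot] at this
    simpa using this
  · right
    have := eqvFun_irreducible hν (W := W.comap Ψ.toLinearMap) (fun u f hf => by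
      obtain ⟨z, g, hu⟩ := exists_eq_smul_specialUnitary hn u
      rw [hu, map_mul, Module.End.mul_apply, eqvRep_scalar, map_smul]
      refine Submodule.smul_mem _ _ ?_
      have := hW g _ hf
      rwa [LinearEquiv.coe_coe, repV_equivSpaceV] at this) hbot
    rw [eq_top_iff]
    intro v _
    have h2 : Ψ.symm v ∈ W.comap Ψ.toLinearMap := by rw [this]; trivial
    simpa using h2

theorem nontrivial_spaceV (hn : 0 < n) {lam : Fin n → ℤ} (hlam : Antitone lam) :
    Nontrivial (spaceV lam).toSubmodule := by
  obtain ⟨ν, c, hν, hc⟩ := exists_normal_form hn hlam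
  exact ⟨_, 0, fun h => eqvTop_ne_zero hν ((LinearEquiv.map_eq_zero_iff (equivSpaceV hν hc)).1 h)⟩

theorem isIrreducible_of_stable {G E : Type*} [Monoid G] [AddCommGroup E] [Module ℂ E]
    [Nontrivial E] {ρ : Representation ℂ G E}
    (h : ∀ W : Submodule ℂ E, (∀ g, ∀ v ∈ W, ρ g v ∈ W) → W = ⊥ ∨ W = ⊤) : ρ.IsIrreducible where
  exists_pair_ne := ⟨⊥, ⊤, fun h => bot_ne_top (α := Submodule ℂ E)
    (congrArg Subrepresentation.toSubmodule h)⟩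
  eq_bot_or_eq_top W := by
    rcases h W.toSubmodule fun g v hv => W.apply_mem_toSubmodule g hv with h | h
    · exact .inl (Subrepresentation.toSubmodule_injective h)
    · exact .inr (Subrepresentation.toSubmodule_injective h)

theorem isIrreducible_repV (hn : 0 < n) {lam : Fin n → ℤ} (hlam : Antitone lam) :
    (repV lam).IsIrreducible :=
  have := nontrivial_spaceV hn hlam
  isIrreducible_of_stable fun _ hW => eq_bot_or_top_of_stable hn hlam hW

theorem torusElt_val (t : Fin n → Circle) :
    (torusElt t : Matrix (Fin n) (Fin n) ℂ) = diagonal fun r => (t r : ℂ) := rfl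

theorem det_torusElt_zpow (t : Fin n → Circle) (c : ℤ) :
    (torusElt t : Matrix (Fin n) (Fin n) ℂ).det ^ c = ∏ r, (t r : ℂ) ^ c := by
  rw [torusElt_val, Matrix.det_diagonal, Finset.prod_zpow]

theorem isIrrepOfHighestWeight_repVU (hn : 0 < n) {lam : Fin n → ℤ} (hlam : Antitone lam) :
    IsIrrepOfHighestWeight (repVU lam) lam := by
  obtain ⟨ν, c, hν, hc⟩ := exists_normal_form hn hlam
  have hnt := nontrivial_spaceV hn hlam
  let Ψ := equivSpaceV hν hc
  have hΨ : ∀ u f, repVU lam u (Ψ f) =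
      (u : Matrix (Fin n) (Fin n) ℂ).det ^ c • Ψ (eqvRep ν u f) := repVU_equivSpaceV hν hc
  refine ⟨Module.Finite.equiv Ψ, fun φ v => ?_, isIrreducible_of_stable fun W hW =>
    eq_bot_or_top_of_stable hn hlam fun g v hv => hW _ v hv, ⟨Ψ (eqvTop hν), ?_, fun t => ?_⟩,
    fun μ v hv => ?_⟩
  · obtain ⟨f, rfl⟩ := Ψ.surjective v
    simp only [hΨ, map_smul, smul_eq_mul]
    refine Continuous.mul (Continuous.zpow₀ ?_ c fun u => .inl (unitary_det_ne_zero u))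
      ((isPolynomialRep_eqvRep ν).continuous (φ.comp Ψ.toLinearMap) f)
    exact Continuous.matrix_det continuous_subtype_val
  · exact fun h => eqvTop_ne_zero hν ((LinearEquiv.map_eq_zero_iff Ψ).1 h)
  · rw [hΨ, det_torusElt_zpow, torusElt_val, (isHighest_eqvTop hν).diagonal, map_smul, smul_smul,
      ← Finset.prod_mul_distrib]
    congr 1
    refine Finset.prod_congr rfl fun r _ => ?_
    rw [hc, add_comm, zpow_add₀ (Circle.coe_ne_zero _), zpow_natCast]
  · obtain ⟨f, rfl⟩ := Ψ.surjective v
    have hf0 : f ≠ 0 := fun h => hv.1 (by rw [h, map_zero])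
    have hmem : f ∈ Submodule.span ℂ (Set.range fun a => eqvRep ν a (eqvTop hν)) := by
      refine Submodule.span_mono ?_ ((span_eqvTop hν).symm ▸ Submodule.mem_top :
        f ∈ Submodule.span ℂ (Set.range fun u : UGrp n => eqvRep ν u (eqvTop hν)))
      rintro _ ⟨u, rfl⟩
      exact ⟨u, rfl⟩
    -- The factor `det ^ c` shifts every weight by `(c, …, c)`, so the polynomial weight to compare
    -- with `ν` is `μ - c`.
    have hdom := (isPolynomialRep_eqvRep ν).dominanceLE (isHighest_eqvTop hν) hmem hf0
      (μ := fun r => μ r - c) fun t => by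
        have h1 := hv.2 t
        rw [hΨ, det_torusElt_zpow, torusElt_val] at h1
        apply Ψ.injective
        have h2 : ∏ r, (t r : ℂ) ^ c ≠ 0 :=
          Finset.prod_ne_zero_iff.2 fun r _ => zpow_ne_zero _ (Circle.coe_ne_zero _)
        apply smul_right_injective _ h2
        simp only
        rw [h1, map_smul, smul_smul, ← Finset.prod_mul_distrib]
        congr 1
        refine Finset.prod_congr rfl fun r _ => ?_
        rw [← zpow_add₀ (Circle.coe_ne_zero _)]
        congr 1
        ring
    constructor
    · have := hdom.1
      simp only [Finset.sum_sub_distrib] at this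
      simp only [hc, Finset.sum_add_distrib]
      linarith
    · intro r
      have := hdom.2 r
      simp only [Finset.sum_sub_distrib] at this
      simp only [hc, Finset.sum_add_distrib]
      linarith

end Transport

/-! ### Tensors as functions of two matrices. -/

section Tensor

variable {n : ℕ}

theorem IsPolynomialRep.tprod {E F : Type*} [AddCommGroup E] [Module ℂ E] [FiniteDimensional ℂ E]
    [AddCommGroup F] [Module ℂ F] {ρ : Representation ℂ (Matrix (Fin n) (Fin n) ℂ) E}
    {σ : Representation ℂ (Matrix (Fin n) (Fin n) ℂ) F} (hρ : IsPolynomialRep ρ)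
    (hσ : IsPolynomialRep σ) : IsPolynomialRep (ρ.tprod σ) := by
  intro φ t
  induction t using TensorProduct.induction_on with
  | zero => simpa using const_mem_polyFun 0
  | add s t hs ht =>
    simp only [map_add]
    exact add_mem hs ht
  | tmul e f =>
    let b := Module.finBasis ℂ E
    have : (fun a => φ (ρ.tprod σ a (e ⊗ₜ f))) =
        ∑ i, (fun a => b.coord i (ρ a e)) * fun a =>
          φ.comp (TensorProduct.mk ℂ E F (b i)) (σ a f) := by
      funext a
      rw [Representation.tprod_apply, TensorProduct.map_tmul]
      have h1 := congrArg (fun e' => φ (e' ⊗ₜ[ℂ] σ a f)) (b.sum_repr (ρ a e))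
      simp only [TensorProduct.sum_tmul, ← TensorProduct.smul_tmul', map_sum, map_smul,
        smul_eq_mul] at h1
      rw [← h1]
      simp
    rw [this]
    exact sum_mem fun i _ => mul_mem (hρ _ _) (hσ _ _)

/-- The function of two matrices defined by a tensor. -/
def pairEval (κ : Fin n → ℕ) : eqvFun κ ⊗[ℂ] eqvFun κ →ₗ[ℂ]
    (Matrix (Fin n) (Fin n) ℂ × Matrix (Fin n) (Fin n) ℂ → ℂ) :=
  TensorProduct.lift (LinearMap.mk₂ ℂ (fun f g p => f.1 p.1 * g.1 p.2)
    (fun _ _ _ => funext fun _ => add_mul _ _ _) (fun _ _ _ => funext fun _ => mul_assoc _ _ _)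
    (fun _ _ _ => funext fun _ => mul_add _ _ _) fun _ _ _ => funext fun _ => mul_left_comm _ _ _)

theorem pairEval_tmul (κ : Fin n → ℕ) (f g : eqvFun κ)
    (p : Matrix (Fin n) (Fin n) ℂ × Matrix (Fin n) (Fin n) ℂ) :
    pairEval κ (f ⊗ₜ g) p = f.1 p.1 * g.1 p.2 := rfl

/-- Linear independence of a basis, as functions, is used once in each variable. -/
theorem pairEval_injective (κ : Fin n → ℕ) : Function.Injective (pairEval κ) := by
  suffices hker : ∀ t, pairEval κ t = 0 → t = 0 by
    intro s t hst
    exact sub_eq_zero.1 (hker (s - t) ((LinearMap.map_sub (pairEval κ) s t).trans (sub_eq_zero.2 hst)))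
  intro t ht
  let b := Module.finBasis ℂ (eqvFun κ)
  have hli : ∀ c : Fin (Module.finrank ℂ (eqvFun κ)) → ℂ, (∀ x, ∑ i, c i * (b i).1 x = 0) →
      ∀ i, c i = 0 := fun c hc => by
    refine Fintype.linearIndependent_iff.1 b.linearIndependent c ?_
    ext x
    simpa using hc x
  have hexp : t = ∑ i, ∑ j, (b.tensorProduct b).repr t (i, j) • (b i ⊗ₜ[ℂ] b j) := by
    conv_lhs => rw [← (b.tensorProduct b).sum_repr t]
    rw [Fintype.sum_prod_type]
    simp only [Module.Basis.tensorProduct_apply]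
  have hc : ∀ i j, (b.tensorProduct b).repr t (i, j) = 0 := by
    intro i j
    refine hli (fun j => (b.tensorProduct b).repr t (i, j)) (fun y => ?_) j
    refine hli (fun i => ∑ j, (b.tensorProduct b).repr t (i, j) * (b j).1 y) (fun x => ?_) i
    have h1 := congrFun ht (x, y)
    rw [hexp] at h1
    simp only [map_sum, map_smul, Finset.sum_apply, Pi.smul_apply, pairEval_tmul, smul_eq_mul,
      Pi.zero_apply] at h1
    rw [← h1]
    refine Finset.sum_congr rfl fun i _ => ?_
    rw [Finset.sum_mul]
    exact Finset.sum_congr rfl fun j _ => by ring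
  rw [hexp]
  simp [hc]

theorem pairEval_tprod (κ : Fin n → ℕ) (a : Matrix (Fin n) (Fin n) ℂ)
    (t : eqvFun κ ⊗[ℂ] eqvFun κ) (x y : Matrix (Fin n) (Fin n) ℂ) :
    pairEval κ ((eqvRep κ).tprod (eqvRep κ) a t) (x, y) = pairEval κ t (x * a, y * a) := by
  induction t using TensorProduct.induction_on with
  | zero => simp
  | add s t hs ht => rw [map_add, map_add, map_add, Pi.add_apply, Pi.add_apply, hs, ht]
  | tmul f g => rfl

theorem pairEval_left_mem (κ : Fin n → ℕ) (t : eqvFun κ ⊗[ℂ] eqvFun κ)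
    (y : Matrix (Fin n) (Fin n) ℂ) : (fun x => pairEval κ t (x, y)) ∈ eqvFun κ := by
  induction t using TensorProduct.induction_on with
  | zero => rw [map_zero]; exact zero_mem (eqvFun κ)
  | add s t hs ht => simp only [map_add, Pi.add_apply]; exact add_mem hs ht
  | tmul f g =>
    have : (fun x => pairEval κ (f ⊗ₜ[ℂ] g) (x, y)) = g.1 y • f.1 := by
      funext x
      exact mul_comm _ _
    rw [this]
    exact Submodule.smul_mem _ _ f.2

theorem pairEval_right_mem (κ : Fin n → ℕ) (t : eqvFun κ ⊗[ℂ] eqvFun κ)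
    (x : Matrix (Fin n) (Fin n) ℂ) : (fun y => pairEval κ t (x, y)) ∈ eqvFun κ := by
  induction t using TensorProduct.induction_on with
  | zero => rw [map_zero]; exact zero_mem (eqvFun κ)
  | add s t hs ht => simp only [map_add, Pi.add_apply]; exact add_mem hs ht
  | tmul f g => exact Submodule.smul_mem (eqvFun κ) (f.1 x) g.2

theorem mul_mem_eqvFun {κ κ' : Fin n → ℕ} {f g : Matrix (Fin n) (Fin n) ℂ → ℂ}
    (hf : f ∈ eqvFun κ) (hg : g ∈ eqvFun κ') : f * g ∈ eqvFun (κ + κ') :=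
  ⟨mul_mem hf.1 hg.1, fun L hL x => by
    simp only [Pi.mul_apply, Pi.add_apply, hf.2 L hL, hg.2 L hL, pow_add, Finset.prod_mul_distrib]
    ring⟩

/-- Weights add when functions are multiplied, so vectors for `k = 1` can be multiplied into vectors
for every `k`. -/
theorem mul_mem_range_pairEval {κ κ' : Fin n → ℕ}
    {F G : Matrix (Fin n) (Fin n) ℂ × Matrix (Fin n) (Fin n) ℂ → ℂ}
    (hF : F ∈ LinearMap.range (pairEval κ)) (hG : G ∈ LinearMap.range (pairEval κ')) :
    F * G ∈ LinearMap.range (pairEval (κ + κ')) := by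
  obtain ⟨s, rfl⟩ := hF
  obtain ⟨t, rfl⟩ := hG
  induction s using TensorProduct.induction_on with
  | zero => simp
  | add s s' hs hs' => rw [map_add, add_mul]; exact add_mem hs hs'
  | tmul f g =>
    induction t using TensorProduct.induction_on with
    | zero => simp
    | add t t' ht ht' => rw [map_add, mul_add]; exact add_mem ht ht'
    | tmul f' g' =>
      refine ⟨⟨_, mul_mem_eqvFun f.2 f'.2⟩ ⊗ₜ ⟨_, mul_mem_eqvFun g.2 g'.2⟩, ?_⟩
      funext p
      exact mul_mul_mul_comm _ _ _ _

end Tensor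

/-! ### The tensor square of the two-row module: uniqueness and possible weights. -/

section TwoRows

variable {n : ℕ}

/-- The weight `(k, k, 0, …, 0)`. -/
def twoRow (n k : ℕ) : Fin n → ℕ := fun r => if (r : ℕ) < 2 then k else 0

theorem twoRow_antitone (n k : ℕ) : Antitone (twoRow n k) := by
  intro i j hij
  have : (i : ℕ) ≤ j := hij
  simp only [twoRow]
  split_ifs <;> omega

theorem twoRow_add (n k l : ℕ) : twoRow n (k + l) = twoRow n k + twoRow n l := by
  funext r
  simp only [twoRow, Pi.add_apply]
  split_ifs <;> rfl

/-- The minor of the first two rows and the columns `a`, `b` (all counted from `0`). -/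
def plucker (h : 4 ≤ n) (a b : Fin 4) (x : Matrix (Fin n) (Fin n) ℂ) : ℂ :=
  x (Fin.castLE h 0) (Fin.castLE h a) * x (Fin.castLE h 1) (Fin.castLE h b) -
    x (Fin.castLE h 0) (Fin.castLE h b) * x (Fin.castLE h 1) (Fin.castLE h a)

theorem minorProduct_twoRow (h : 4 ≤ n) (k : ℕ) (x : Matrix (Fin n) (Fin n) ℂ) :
    minorProduct (twoRow n k) x = plucker h 0 1 x ^ k := by
  rw [minorProduct, Finset.prod_eq_single (Fin.castLE h 1)]
  · have h1 : gap (twoRow n k) (Fin.castLE h 1) = k := by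
      simp [gap, twoRow]
    rw [h1]
    congr 1
    exact Matrix.det_fin_two _
  · intro r _ hr
    have hr' : (r : ℕ) ≠ 1 := fun hh => hr (Fin.ext hh)
    have h1 : gap (twoRow n k) r = 0 := by
      simp only [gap, twoRow]
      split_ifs <;> omega
    rw [h1, pow_zero]
  · simp

theorem sum_four (h : 4 ≤ n) {g : Fin n → ℂ} (hg : ∀ s : Fin n, 4 ≤ (s : ℕ) → g s = 0) :
    ∑ s, g s = g (Fin.castLE h 0) + g (Fin.castLE h 1) + g (Fin.castLE h 2) +
      g (Fin.castLE h 3) := by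
  rw [← Fin.sum_univ_four fun a => g (Fin.castLE h a)]
  refine Eq.trans ?_ (Finset.sum_map Finset.univ (Fin.castLEEmb h) g)
  refine (Finset.sum_subset (Finset.subset_univ _) fun s _ hs => hg s ?_).symm
  by_contra hlt
  exact hs (Finset.mem_map.2 ⟨⟨s, by omega⟩, Finset.mem_univ _, rfl⟩)

theorem prod_four (h : 4 ≤ n) {g : Fin n → ℂ} (hg : ∀ s : Fin n, 4 ≤ (s : ℕ) → g s = 1) :
    ∏ s, g s = g (Fin.castLE h 0) * g (Fin.castLE h 1) * g (Fin.castLE h 2) *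
      g (Fin.castLE h 3) := by
  rw [← Fin.prod_univ_four fun a => g (Fin.castLE h a)]
  refine Eq.trans ?_ (Finset.prod_map Finset.univ (Fin.castLEEmb h) g)
  refine (Finset.prod_subset (Finset.subset_univ _) fun s _ hs => hg s ?_).symm
  by_contra hlt
  exact hs (Finset.mem_map.2 ⟨⟨s, by omega⟩, Finset.mem_univ _, rfl⟩)

/-- Functions in `eqvFun (k, k, 0, …, 0)` depend only on the first two rows, up to the action of
`GL(2)` by a power of the determinant. -/
theorem eqvFun_twoRow_apply (h : 4 ≤ n) {k : ℕ} {f : Matrix (Fin n) (Fin n) ℂ → ℂ}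
    (hf : f ∈ eqvFun (twoRow n k)) {x x' : Matrix (Fin n) (Fin n) ℂ} {p q r s : ℂ}
    (h0 : ∀ j, x' (Fin.castLE h 0) j = p * x (Fin.castLE h 0) j + q * x (Fin.castLE h 1) j)
    (h1 : ∀ j, x' (Fin.castLE h 1) j = r * x (Fin.castLE h 0) j + s * x (Fin.castLE h 1) j) :
    f x' = (p * s - q * r) ^ k * f x := by
  -- It suffices to treat translates of the generator, a `k`-th power of a minor of the first two
  -- rows; a row operation multiplies this minor by its determinant.
  have hmem : (⟨f, hf⟩ : eqvFun (twoRow n k)) ∈ Submodule.span ℂ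
      (Set.range fun u : UGrp n => eqvRep (twoRow n k) u (eqvTop (twoRow_antitone n k))) := by
    rw [span_eqvTop]
    trivial
  suffices ∀ g : eqvFun (twoRow n k), g ∈ Submodule.span ℂ
      (Set.range fun u : UGrp n => eqvRep (twoRow n k) u (eqvTop (twoRow_antitone n k))) →
      g.1 x' = (p * s - q * r) ^ k * g.1 x from this ⟨f, hf⟩ hmem
  intro g hg
  induction hg using Submodule.span_induction with
  | mem g hg =>
    obtain ⟨u, rfl⟩ := hg
    change minorProduct (twoRow n k) (x' * u) = _ * minorProduct (twoRow n k) (x * u)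
    rw [minorProduct_twoRow h, minorProduct_twoRow h, ← mul_pow]
    congr 1
    have e0 : ∀ j, (x' * u.1) (Fin.castLE h 0) j =
        p * (x * u.1) (Fin.castLE h 0) j + q * (x * u.1) (Fin.castLE h 1) j := fun j => by
      simp only [Matrix.mul_apply, h0, Finset.mul_sum, ← Finset.sum_add_distrib]
      exact Finset.sum_congr rfl fun i _ => by ring
    have e1 : ∀ j, (x' * u.1) (Fin.castLE h 1) j =
        r * (x * u.1) (Fin.castLE h 0) j + s * (x * u.1) (Fin.castLE h 1) j := fun j => by
      simp only [Matrix.mul_apply, h1, Finset.mul_sum, ← Finset.sum_add_distrib]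
      exact Finset.sum_congr rfl fun i _ => by ring
    simp only [plucker, e0, e1]
    ring
  | zero => simp
  | add g g' _ _ hg hg' =>
    change g.1 x' + g'.1 x' = _ * (g.1 x + g'.1 x)
    rw [hg, hg', mul_add]
  | smul c g _ hg =>
    change c * g.1 x' = _ * (c * g.1 x)
    rw [hg]
    ring

/-- A matrix whose first two rows have non-zero minors in the columns `01`, `02` and `23`. -/
def basePoint (h : 4 ≤ n) : Matrix (Fin n) (Fin n) ℂ := Matrix.of fun i j =>
  if i = Fin.castLE h 0 then (if j = Fin.castLE h 0 ∨ j = Fin.castLE h 3 then 1 else 0)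
  else if i = Fin.castLE h 1 then (if j = Fin.castLE h 1 ∨ j = Fin.castLE h 2 then 1 else 0)
  else 0

theorem basePoint_mul_zero (h : 4 ≤ n) (b : Matrix (Fin n) (Fin n) ℂ) (j : Fin n) :
    (basePoint h * b) (Fin.castLE h 0) j = b (Fin.castLE h 0) j + b (Fin.castLE h 3) j := by
  rw [Matrix.mul_apply, sum_four h]
  · simp [basePoint, Fin.ext_iff]
  · intro s hs
    have h0 : (s : ℕ) ≠ 0 := by omega
    have h3 : (s : ℕ) ≠ 3 := by omega
    simp [basePoint, Fin.ext_iff, h0, h3]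

theorem basePoint_mul_one (h : 4 ≤ n) (b : Matrix (Fin n) (Fin n) ℂ) (j : Fin n) :
    (basePoint h * b) (Fin.castLE h 1) j = b (Fin.castLE h 1) j + b (Fin.castLE h 2) j := by
  rw [Matrix.mul_apply, sum_four h]
  · simp [basePoint, Fin.ext_iff]
  · intro s hs
    have h0 : (s : ℕ) ≠ 1 := by omega
    have h3 : (s : ℕ) ≠ 2 := by omega
    simp [basePoint, Fin.ext_iff, h0, h3]

theorem plucker_mem_polyFun (h : 4 ≤ n) (a b : Fin 4) :
    plucker h a b ∈ polyFun (Matrix (Fin n) (Fin n) ℂ) :=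
  sub_mem (mul_mem (entry_mem_polyFun _ _) (entry_mem_polyFun _ _))
    (mul_mem (entry_mem_polyFun _ _) (entry_mem_polyFun _ _))

variable {k : ℕ} {μ : Fin n → ℕ} {t : eqvFun (twoRow n k) ⊗[ℂ] eqvFun (twoRow n k)}

theorem pairEval_mul_upper
    (ht : IsHighest ((eqvRep (twoRow n k)).tprod (eqvRep (twoRow n k))) μ t)
    {b : Matrix (Fin n) (Fin n) ℂ} (hb : ∀ i j, j < i → b i j = 0)
    (x y : Matrix (Fin n) (Fin n) ℂ) :
    pairEval _ t (x * b, y * b) = (∏ i, b i i ^ μ i) * pairEval _ t (x, y) := by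
  rw [← pairEval_tprod, ht b hb, map_smul]
  rfl

/-- A highest weight vector of the tensor square is determined by one value. -/
theorem eq_zero_of_pairEval_basePoint (h : 4 ≤ n)
    (ht : IsHighest ((eqvRep (twoRow n k)).tprod (eqvRep (twoRow n k))) μ t)
    (h0 : pairEval _ t (1, basePoint h) = 0) : t = 0 := by
  have hy : ∀ y, (plucker h 0 2 y ^ 2 * plucker h 0 1 y) ^ k * pairEval _ t (1, y) = 0 := by
    intro y
    -- `r0` and `r1` combine the first two rows of `y` so as to vanish in columns `2` and `0`. Their
    -- halves are arranged in `b` so that `b` is upper triangular, its first two rows lie in the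
    -- span of those of `1`, and those of `basePoint h * b` are `r0` and `r1`. This links the values
    -- at `(1, basePoint h)` and `(1, y)`; the row operations produce the Plücker factor.
    let r0 : Fin n → ℂ := fun j => -y (Fin.castLE h 1) (Fin.castLE h 2) * y (Fin.castLE h 0) j +
      y (Fin.castLE h 0) (Fin.castLE h 2) * y (Fin.castLE h 1) j
    let r1 : Fin n → ℂ := fun j => -y (Fin.castLE h 1) (Fin.castLE h 0) * y (Fin.castLE h 0) j +
      y (Fin.castLE h 0) (Fin.castLE h 0) * y (Fin.castLE h 1) j
    have hr0 : r0 (Fin.castLE h 2) = 0 := by simp only [r0]; ring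
    have hr1 : r1 (Fin.castLE h 0) = 0 := by simp only [r1]; ring
    let b : Matrix (Fin n) (Fin n) ℂ := Matrix.of fun i j =>
      if i = Fin.castLE h 0 then (if (j : ℕ) < 2 then r0 j else 0)
      else if i = Fin.castLE h 1 then (if (j : ℕ) < 2 then r1 j else 0)
      else if i = Fin.castLE h 2 then (if (j : ℕ) < 2 then 0 else r1 j)
      else if i = Fin.castLE h 3 then (if (j : ℕ) < 2 then 0 else r0 j)
      else 0
    have b0 : ∀ j, b (Fin.castLE h 0) j = if (j : ℕ) < 2 then r0 j else 0 := fun j => by simp [b]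
    have b1 : ∀ j, b (Fin.castLE h 1) j = if (j : ℕ) < 2 then r1 j else 0 := fun j => by
      simp [b, Fin.ext_iff]
    have b2 : ∀ j, b (Fin.castLE h 2) j = if (j : ℕ) < 2 then 0 else r1 j := fun j => by
      simp [b, Fin.ext_iff]
    have b3 : ∀ j, b (Fin.castLE h 3) j = if (j : ℕ) < 2 then 0 else r0 j := fun j => by
      simp [b, Fin.ext_iff]
    have hb : ∀ i j, j < i → b i j = 0 := by
      intro i j hij
      have hij' : (j : ℕ) < i := hij
      by_cases i0 : i = Fin.castLE h 0
      · subst i0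
        exact absurd hij' (Nat.not_lt_zero _)
      by_cases i1 : i = Fin.castLE h 1
      · have : j = Fin.castLE h 0 := Fin.ext (by
          rw [i1] at hij'
          simp at hij'
          simp [hij'])
        rw [i1, b1, this, hr1]
        simp
      by_cases i2 : i = Fin.castLE h 2
      · rw [i2, b2, if_pos]
        rwa [i2] at hij'
      by_cases i3 : i = Fin.castLE h 3
      · rw [i3, b3]
        split_ifs with hj
        · rfl
        · have : j = Fin.castLE h 2 := Fin.ext (by
            rw [i3] at hij'
            simp at hij' ⊢
            omega)
          rw [this, hr0]
      simp [b, i0, i1, i2, i3]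
    have e1 := pairEval_mul_upper ht hb 1 (basePoint h)
    rw [h0, mul_zero, one_mul] at e1
    have e2 := eqvFun_twoRow_apply h (pairEval_left_mem _ t (basePoint h * b)) (x := 1) (x' := b)
      (p := r0 (Fin.castLE h 0)) (q := r0 (Fin.castLE h 1)) (r := 0) (s := r1 (Fin.castLE h 1))
      (fun j => by
        rw [b0]
        by_cases j0 : j = Fin.castLE h 0
        · subst j0; simp [Fin.ext_iff]
        by_cases j1 : j = Fin.castLE h 1
        · subst j1; simp [Fin.ext_iff]
        have : ¬ (j : ℕ) < 2 := fun hj => by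
          have h0' : (j : ℕ) ≠ 0 := fun hh => j0 (Fin.ext hh)
          have h1' : (j : ℕ) ≠ 1 := fun hh => j1 (Fin.ext hh)
          omega
        simp [this, Ne.symm j0, Ne.symm j1])
      (fun j => by
        rw [b1]
        by_cases j0 : j = Fin.castLE h 0
        · subst j0; simp [Fin.ext_iff, hr1]
        by_cases j1 : j = Fin.castLE h 1
        · subst j1; simp [Fin.ext_iff]
        have : ¬ (j : ℕ) < 2 := fun hj => by
          have h0' : (j : ℕ) ≠ 0 := fun hh => j0 (Fin.ext hh)
          have h1' : (j : ℕ) ≠ 1 := fun hh => j1 (Fin.ext hh)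
          omega
        simp [this, Ne.symm j0, Ne.symm j1])
    have e3 := eqvFun_twoRow_apply h (pairEval_right_mem _ t 1) (x := y) (x' := basePoint h * b)
      (p := -y (Fin.castLE h 1) (Fin.castLE h 2)) (q := y (Fin.castLE h 0) (Fin.castLE h 2))
      (r := -y (Fin.castLE h 1) (Fin.castLE h 0)) (s := y (Fin.castLE h 0) (Fin.castLE h 0))
      (fun j => by
        rw [basePoint_mul_zero, b0, b3]
        split_ifs <;> simp [r0])
      (fun j => by
        rw [basePoint_mul_one, b1, b2]
        split_ifs <;> simp [r1])
    rw [e1, e3, ← mul_assoc, ← mul_pow] at e2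
    rw [e2]
    congr 2
    simp only [plucker, r0, r1]
    ring
  -- The Plücker factor is nonzero at `basePoint h`, so it can be cancelled.
  have h1y : ∀ y, pairEval _ t (1, y) = 0 := by
    refine (polyFun_mul_eq_zero (pow_mem (mul_mem (pow_mem (plucker_mem_polyFun h 0 2) 2)
      (plucker_mem_polyFun h 0 1)) k) (pairEval_right_mem _ t 1).1 hy).resolve_left fun hz => ?_
    have := hz (basePoint h)
    simp [plucker, basePoint, Fin.ext_iff] at this
  -- For `x = L * U`, `L` comes out as a scalar and `U` acts on both arguments at once, leaving the
  -- value at `(1, y * U⁻¹)`.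
  have hxy : ∀ x y, pairEval _ t (x, y) = 0 := by
    intro x y
    refine eq_zero_of_lower_mul_upper (pairEval_left_mem _ t y).1 (fun L U hL hU hu => ?_) x
    refine ((pairEval_left_mem _ t y).2 L hL U).trans ?_
    have hy' : y = y * U⁻¹ * U := by
      rw [Matrix.mul_assoc, Matrix.nonsing_inv_mul _ ((Matrix.isUnit_iff_isUnit_det _).1 hu),
        mul_one]
    have := pairEval_mul_upper ht hU 1 (y * U⁻¹)
    rw [← hy', one_mul, h1y, mul_zero] at this
    exact mul_eq_zero_of_right _ this
  exact pairEval_injective _ (by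
    rw [map_zero]
    funext p
    exact hxy p.1 p.2)

/-- The weight `(2k - i, 2k - j, j, i, 0, …, 0)`. -/
def fourRowWeight (n k i j : ℕ) : Fin n → ℕ := fun r => [2 * k - i, 2 * k - j, j, i].getD r 0

/-- The highest weights of the tensor square. -/
theorem exists_eq_fourRowWeight (h : 4 ≤ n)
    (ht : IsHighest ((eqvRep (twoRow n k)).tprod (eqvRep (twoRow n k))) μ t) (ht0 : t ≠ 0) :
    ∃ i j, i ≤ j ∧ j ≤ k ∧ μ = fourRowWeight n k i j := by
  have h0 : pairEval _ t (1, basePoint h) ≠ 0 := fun h0 =>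
    ht0 (eq_zero_of_pairEval_basePoint h ht h0)
  have hanti : Antitone μ :=
    ((isPolynomialRep_eqvRep _).tprod (isPolynomialRep_eqvRep _)).antitone ht ht0
  -- The first two rows of `basePoint h` are supported in columns `0, 3` and `1, 2`, so such a `d`
  -- merely rescales the relevant rows of `1` and `basePoint h`. Each factor contributes `(d 0 * d
  -- 1) ^ k`, and the value at this point is nonzero.
  have key : ∀ d : Fin n → ℂ, d (Fin.castLE h 3) = d (Fin.castLE h 0) →
      d (Fin.castLE h 2) = d (Fin.castLE h 1) →
      ∏ i, d i ^ μ i = (d (Fin.castLE h 0) * d (Fin.castLE h 1)) ^ (2 * k) := by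
    intro d h30 h21
    have e1 := pairEval_mul_upper ht (b := diagonal d) (fun i j hij => diagonal_apply_ne _ hij.ne')
      1 (basePoint h)
    simp only [diagonal_apply_eq, one_mul] at e1
    have e2 := eqvFun_twoRow_apply h (pairEval_left_mem _ t (basePoint h * diagonal d)) (x := 1)
      (x' := diagonal d) (p := d (Fin.castLE h 0)) (q := 0) (r := 0) (s := d (Fin.castLE h 1))
      (fun j => by
        by_cases hj : Fin.castLE h 0 = j
        · subst hj; simp
        · simp [hj, Matrix.one_apply])
      (fun j => by
        by_cases hj : Fin.castLE h 1 = j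
        · subst hj; simp
        · simp [hj, Matrix.one_apply])
    have e3 := eqvFun_twoRow_apply h (pairEval_right_mem _ t 1) (x := basePoint h)
      (x' := basePoint h * diagonal d) (p := d (Fin.castLE h 0)) (q := 0) (r := 0)
      (s := d (Fin.castLE h 1))
      (fun j => by
        rw [Matrix.mul_diagonal]
        by_cases j0 : j = Fin.castLE h 0
        · subst j0; simp [mul_comm]
        by_cases j3 : j = Fin.castLE h 3
        · subst j3; simp [h30, mul_comm]
        simp [basePoint, j0, j3])
      (fun j => by
        rw [Matrix.mul_diagonal]
        by_cases j0 : j = Fin.castLE h 1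
        · subst j0; simp [mul_comm]
        by_cases j3 : j = Fin.castLE h 2
        · subst j3; simp [h21, mul_comm]
        have h10 : Fin.castLE h 1 ≠ Fin.castLE h 0 := by simp
        simp only [basePoint, Matrix.of_apply, h10, if_false, if_true, j0, j3, or_self]
        ring)
    rw [e1, e3, ← mul_assoc] at e2
    rw [mul_right_cancel₀ h0 e2]
    ring
  have hpow : ∀ a b : ℕ, (2 : ℂ) ^ a = 2 ^ b → a = b := fun a b hab =>
    Nat.pow_right_injective le_rfl (by exact_mod_cast hab)
  have hlt : ∀ s : Fin n, 4 ≤ (s : ℕ) → μ s = 0 := fun s hs => by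
    have h1 := key (fun r => if r = s then 2 else 1)
      (by rw [if_neg, if_neg] <;> (intro hh; rw [← hh] at hs; simp at hs))
      (by rw [if_neg, if_neg] <;> (intro hh; rw [← hh] at hs; simp at hs))
    rw [if_neg (by intro hh; rw [← hh] at hs; simp at hs),
      if_neg (by intro hh; rw [← hh] at hs; simp at hs),
      Finset.prod_eq_single s (fun j _ hj => by simp [hj]) (by simp), if_pos rfl] at h1
    exact hpow _ _ (by simpa using h1)
  have h03 : μ (Fin.castLE h 0) + μ (Fin.castLE h 3) = 2 * k := by
    have h1 := key (fun r => if r = Fin.castLE h 0 ∨ r = Fin.castLE h 3 then 2 else 1)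
      (by simp) (by simp [Fin.ext_iff])
    rw [prod_four h fun s hs => by simp [hlt s hs]] at h1
    exact hpow _ _ (by simpa [Fin.ext_iff, ← pow_add] using h1)
  have h12 : μ (Fin.castLE h 1) + μ (Fin.castLE h 2) = 2 * k := by
    have h1 := key (fun r => if r = Fin.castLE h 1 ∨ r = Fin.castLE h 2 then 2 else 1)
      (by simp [Fin.ext_iff]) (by simp)
    rw [prod_four h fun s hs => by simp [hlt s hs]] at h1
    exact hpow _ _ (by simpa [Fin.ext_iff, ← pow_add] using h1)
  -- Dominance gives `i ≤ j`, and `h12` with `m21` gives `2 * j ≤ 2 * k`.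
  have m32 : μ (Fin.castLE h 3) ≤ μ (Fin.castLE h 2) := hanti (by simp [Fin.le_def])
  have m21 : μ (Fin.castLE h 2) ≤ μ (Fin.castLE h 1) := hanti (by simp [Fin.le_def])
  refine ⟨μ (Fin.castLE h 3), μ (Fin.castLE h 2), m32, by omega, ?_⟩
  funext r
  by_cases r4 : 4 ≤ (r : ℕ)
  · rw [hlt r r4, fourRowWeight, List.getD_eq_default]
    simpa using r4
  · have hr : r = Fin.castLE h ⟨r, by omega⟩ := rfl
    generalize (⟨r, by omega⟩ : Fin 4) = a at hr
    subst hr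
    fin_cases a
    · change μ (Fin.castLE h 0) = 2 * k - μ (Fin.castLE h 3)
      omega
    · change μ (Fin.castLE h 1) = 2 * k - μ (Fin.castLE h 2)
      omega
    · rfl
    · rfl

end TwoRows

/-! ### Explicit highest weight vectors in the tensor square. -/

section HighestWeightVectors

variable {n : ℕ}

theorem plucker_mem_eqvFun (h : 4 ≤ n) (a b : Fin 4) : plucker h a b ∈ eqvFun (twoRow n 1) := by
  refine ⟨plucker_mem_polyFun h a b, fun L hL x => ?_⟩
  have h0 : ∀ j, (L * x) (Fin.castLE h 0) j =
      L (Fin.castLE h 0) (Fin.castLE h 0) * x (Fin.castLE h 0) j := fun j => by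
    rw [Matrix.mul_apply, Finset.sum_eq_single (Fin.castLE h 0)]
    · intro s _ hs
      rw [hL _ s, zero_mul]
      exact Fin.lt_def.2 (Nat.pos_of_ne_zero fun hh => hs (Fin.ext hh))
    · simp
  have h1 : ∀ j, (L * x) (Fin.castLE h 1) j =
      L (Fin.castLE h 1) (Fin.castLE h 0) * x (Fin.castLE h 0) j +
      L (Fin.castLE h 1) (Fin.castLE h 1) * x (Fin.castLE h 1) j := fun j => by
    rw [Matrix.mul_apply, sum_four h, hL _ (Fin.castLE h 2), hL _ (Fin.castLE h 3)]
    · ring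
    · simp [Fin.lt_def]
    · simp [Fin.lt_def]
    · intro s hs
      rw [hL _ s, zero_mul]
      exact Fin.lt_def.2 (lt_of_lt_of_le (by simp) hs)
  rw [prod_four h]
  · simp only [plucker, h0, h1]
    simp [twoRow]
    ring
  · intro s hs
    have : ¬ (s : ℕ) < 2 := by omega
    simp [twoRow, this]

/-- Products of minors in two matrices, as elements of the tensor square. -/
theorem plucker_mul_mem_range (h : 4 ≤ n) (a b c d : Fin 4) :
    (fun p : Matrix (Fin n) (Fin n) ℂ × Matrix (Fin n) (Fin n) ℂ =>
      plucker h a b p.1 * plucker h c d p.2) ∈ LinearMap.range (pairEval (twoRow n 1)) :=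
  ⟨⟨_, plucker_mem_eqvFun h a b⟩ ⊗ₜ ⟨_, plucker_mem_eqvFun h c d⟩, rfl⟩

theorem pow_mem_range_pairEval
    {F : Matrix (Fin n) (Fin n) ℂ × Matrix (Fin n) (Fin n) ℂ → ℂ}
    (hF : F ∈ LinearMap.range (pairEval (twoRow n 1))) (k : ℕ) :
    F ^ k ∈ LinearMap.range (pairEval (twoRow n k)) := by
  induction k with
  | zero =>
    have h1 : (fun _ => 1) ∈ eqvFun (twoRow n 0) :=
      ⟨const_mem_polyFun 1, fun L _ x => by simp [twoRow]⟩
    refine ⟨⟨_, h1⟩ ⊗ₜ ⟨_, h1⟩, ?_⟩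
    funext p
    simp [pairEval_tmul]
  | succ k ih =>
    rw [pow_succ, twoRow_add]
    exact mul_mem_range_pairEval ih hF

/-- The highest weight vector of weight `(2, 1, 1, 0, …, 0)`. -/
def hookVector (h : 4 ≤ n) (p : Matrix (Fin n) (Fin n) ℂ × Matrix (Fin n) (Fin n) ℂ) : ℂ :=
  plucker h 0 1 p.1 * plucker h 0 2 p.2 - plucker h 0 2 p.1 * plucker h 0 1 p.2

/-- The highest weight vector of weight `(1, 1, 1, 1, 0, …, 0)`: a Laplace expansion. -/
def columnVector (h : 4 ≤ n) (p : Matrix (Fin n) (Fin n) ℂ × Matrix (Fin n) (Fin n) ℂ) : ℂ :=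
  plucker h 0 1 p.1 * plucker h 2 3 p.2 - plucker h 0 2 p.1 * plucker h 1 3 p.2 +
    plucker h 0 3 p.1 * plucker h 1 2 p.2 + plucker h 1 2 p.1 * plucker h 0 3 p.2 -
    plucker h 1 3 p.1 * plucker h 0 2 p.2 + plucker h 2 3 p.1 * plucker h 0 1 p.2

/-- The highest weight vector of weight `(2, 2, 0, …, 0)`. -/
def squareVector (h : 4 ≤ n) (p : Matrix (Fin n) (Fin n) ℂ × Matrix (Fin n) (Fin n) ℂ) : ℂ :=
  plucker h 0 1 p.1 * plucker h 0 1 p.2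

theorem mul_upper_apply (h : 4 ≤ n) {b : Matrix (Fin n) (Fin n) ℂ}
    (hb : ∀ i j, j < i → b i j = 0) (x : Matrix (Fin n) (Fin n) ℂ) (i : Fin n) (c : Fin 4) :
    (x * b) i (Fin.castLE h c) = ∑ a : Fin 4, if a ≤ c then
      x i (Fin.castLE h a) * b (Fin.castLE h a) (Fin.castLE h c) else 0 := by
  have hz : ∀ a : Fin n, (c : ℕ) < a → b a (Fin.castLE h c) = 0 := fun a ha => hb _ _ ha
  rw [Matrix.mul_apply, sum_four h fun s hs => by rw [hz s (by omega), mul_zero],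
    ← Fin.sum_univ_four fun a =>
      x i (Fin.castLE h a) * b (Fin.castLE h a) (Fin.castLE h c)]
  refine Finset.sum_congr rfl fun a _ => ?_
  split_ifs with hac
  · rfl
  · rw [hz _ (not_le.1 hac), mul_zero]

theorem columns_mul_upper (h : 4 ≤ n) {b : Matrix (Fin n) (Fin n) ℂ}
    (hb : ∀ i j, j < i → b i j = 0) (x : Matrix (Fin n) (Fin n) ℂ) (i : Fin n) :
    (x * b) i (Fin.castLE h 0) = x i (Fin.castLE h 0) * b (Fin.castLE h 0) (Fin.castLE h 0) ∧
    (x * b) i (Fin.castLE h 1) = x i (Fin.castLE h 0) * b (Fin.castLE h 0) (Fin.castLE h 1) +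
      x i (Fin.castLE h 1) * b (Fin.castLE h 1) (Fin.castLE h 1) ∧
    (x * b) i (Fin.castLE h 2) = x i (Fin.castLE h 0) * b (Fin.castLE h 0) (Fin.castLE h 2) +
      x i (Fin.castLE h 1) * b (Fin.castLE h 1) (Fin.castLE h 2) +
      x i (Fin.castLE h 2) * b (Fin.castLE h 2) (Fin.castLE h 2) ∧
    (x * b) i (Fin.castLE h 3) = x i (Fin.castLE h 0) * b (Fin.castLE h 0) (Fin.castLE h 3) +
      x i (Fin.castLE h 1) * b (Fin.castLE h 1) (Fin.castLE h 3) +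
      x i (Fin.castLE h 2) * b (Fin.castLE h 2) (Fin.castLE h 3) +
      x i (Fin.castLE h 3) * b (Fin.castLE h 3) (Fin.castLE h 3) := by
  have e (p q : Fin 4) : (p ≤ q) = ((p : ℕ) ≤ q) := rfl
  refine ⟨?_, ?_, ?_, ?_⟩ <;> rw [mul_upper_apply h hb, Fin.sum_univ_four] <;> simp [e]

theorem squareVector_mul_upper (h : 4 ≤ n) {b : Matrix (Fin n) (Fin n) ℂ}
    (hb : ∀ i j, j < i → b i j = 0) (x y : Matrix (Fin n) (Fin n) ℂ) :
    squareVector h (x * b, y * b) =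
      (b (Fin.castLE h 0) (Fin.castLE h 0) * b (Fin.castLE h 1) (Fin.castLE h 1)) ^ 2 *
        squareVector h (x, y) := by
  simp only [squareVector, plucker, (columns_mul_upper h hb _ _).1,
    (columns_mul_upper h hb _ _).2.1]
  ring

theorem hookVector_mul_upper (h : 4 ≤ n) {b : Matrix (Fin n) (Fin n) ℂ}
    (hb : ∀ i j, j < i → b i j = 0) (x y : Matrix (Fin n) (Fin n) ℂ) :
    hookVector h (x * b, y * b) =
      b (Fin.castLE h 0) (Fin.castLE h 0) ^ 2 * b (Fin.castLE h 1) (Fin.castLE h 1) *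
        b (Fin.castLE h 2) (Fin.castLE h 2) * hookVector h (x, y) := by
  simp only [hookVector, plucker, (columns_mul_upper h hb _ _).1,
    (columns_mul_upper h hb _ _).2.1, (columns_mul_upper h hb _ _).2.2.1]
  ring

theorem columnVector_mul_upper (h : 4 ≤ n) {b : Matrix (Fin n) (Fin n) ℂ}
    (hb : ∀ i j, j < i → b i j = 0) (x y : Matrix (Fin n) (Fin n) ℂ) :
    columnVector h (x * b, y * b) =
      b (Fin.castLE h 0) (Fin.castLE h 0) * b (Fin.castLE h 1) (Fin.castLE h 1) *
        b (Fin.castLE h 2) (Fin.castLE h 2) * b (Fin.castLE h 3) (Fin.castLE h 3) *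
        columnVector h (x, y) := by
  simp only [columnVector, plucker, (columns_mul_upper h hb _ _).1,
    (columns_mul_upper h hb _ _).2.1, (columns_mul_upper h hb _ _).2.2.1,
    (columns_mul_upper h hb _ _).2.2.2]
  ring

theorem prod_pow_fourRowWeight (h : 4 ≤ n) (k i j : ℕ) (g : Fin n → ℂ) :
    ∏ s, g s ^ fourRowWeight n k i j s = g (Fin.castLE h 0) ^ (2 * k - i) *
      g (Fin.castLE h 1) ^ (2 * k - j) * g (Fin.castLE h 2) ^ j * g (Fin.castLE h 3) ^ i := by
  rw [prod_four h]
  · rfl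
  · intro s hs
    rw [fourRowWeight, List.getD_eq_default _ _ (by simpa using hs), pow_zero]

/-- The highest weight vectors of the tensor square. -/
theorem exists_isHighest_fourRowWeight (h : 4 ≤ n) {k i j : ℕ} (hij : i ≤ j) (hjk : j ≤ k) :
    ∃ t : eqvFun (twoRow n k) ⊗[ℂ] eqvFun (twoRow n k), t ≠ 0 ∧
      IsHighest ((eqvRep (twoRow n k)).tprod (eqvRep (twoRow n k)))
        (fourRowWeight n k i j) t := by
  have hsq : squareVector h ∈ LinearMap.range (pairEval (twoRow n 1)) :=
    plucker_mul_mem_range h 0 1 0 1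
  have hhook : hookVector h ∈ LinearMap.range (pairEval (twoRow n 1)) :=
    sub_mem (plucker_mul_mem_range h 0 1 0 2) (plucker_mul_mem_range h 0 2 0 1)
  have hcol : columnVector h ∈ LinearMap.range (pairEval (twoRow n 1)) :=
    add_mem (sub_mem (add_mem (add_mem (sub_mem (plucker_mul_mem_range h 0 1 2 3)
      (plucker_mul_mem_range h 0 2 1 3)) (plucker_mul_mem_range h 0 3 1 2))
      (plucker_mul_mem_range h 1 2 0 3)) (plucker_mul_mem_range h 1 3 0 2))
      (plucker_mul_mem_range h 2 3 0 1)
  -- The weights `(2,2,0,0)`, `(2,1,1,0)` and `(1,1,1,1)`, taken `k - j`, `j - i` and `i` times, add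
  -- up to `(2k - i, 2k - j, j, i)`.
  have hmem := mul_mem_range_pairEval (mul_mem_range_pairEval
    (pow_mem_range_pairEval hsq (k - j)) (pow_mem_range_pairEval hhook (j - i)))
    (pow_mem_range_pairEval hcol i)
  rw [← twoRow_add, ← twoRow_add, show k - j + (j - i) + i = k by omega] at hmem
  obtain ⟨t, ht⟩ := hmem
  have hval : ∀ p, pairEval _ t p =
      squareVector h p ^ (k - j) * hookVector h p ^ (j - i) * columnVector h p ^ i := fun p => by
    rw [ht]
    rfl
  refine ⟨t, fun h0 => ?_, fun b hb => pairEval_injective _ ?_⟩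
  -- At this point the square, hook and column vectors take the values `1`, `1` and `-1`.
  · have h1 := hval (1, basePoint h)
    rw [h0] at h1
    have h2 : (0 : ℂ) = squareVector h (1, basePoint h) ^ (k - j) *
        hookVector h (1, basePoint h) ^ (j - i) * columnVector h (1, basePoint h) ^ i :=
      (congrFun (LinearMap.map_zero (pairEval (twoRow n k))) (1, basePoint h)).symm.trans h1
    have e (p q : Fin n) : (1 : Matrix (Fin n) (Fin n) ℂ) p q = if (p : ℕ) = q then 1 else 0 := by
      simp [Matrix.one_apply, Fin.ext_iff]
    simp [squareVector, hookVector, columnVector, plucker, e, basePoint, Fin.ext_iff] at h2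
    exact pow_ne_zero i (neg_ne_zero.2 one_ne_zero) h2.symm
  · funext p
    obtain ⟨x, y⟩ := p
    rw [pairEval_tprod, LinearMap.map_smul, Pi.smul_apply, hval, hval, squareVector_mul_upper h hb,
      hookVector_mul_upper h hb, columnVector_mul_upper h hb,
      prod_pow_fourRowWeight h k i j fun s => b s s,
      show 2 * k - i = 2 * (k - j) + 2 * (j - i) + i by omega,
      show 2 * k - j = 2 * (k - j) + (j - i) + i by omega,
      show b (Fin.castLE h 2) (Fin.castLE h 2) ^ j =
        b (Fin.castLE h 2) (Fin.castLE h 2) ^ (j - i + i) by rw [Nat.sub_add_cancel hij]]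
    simp only [mul_pow, pow_add, pow_mul, smul_eq_mul]
    ring

end HighestWeightVectors

/-! ### Decomposition into irreducible summands. -/

section Decomposition

variable {n : ℕ}

/-- The matrix coefficients `x ↦ B(w, ρ(x) e)` for a highest weight vector `w`. -/
def coeffMap {E : Type*} [AddCommGroup E] [Module ℂ E]
    {ρ : Representation ℂ (Matrix (Fin n) (Fin n) ℂ) E} (hρ : IsPolynomialRep ρ)
    {B : E →ₗ⋆[ℂ] E →ₗ[ℂ] ℂ} (hB : ∀ a v w, B w (ρ a v) = B (ρ aᴴ w) v) {ν : Fin n → ℕ} {w : E}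
    (hw : IsHighest ρ ν w) : E →ₗ[ℂ] eqvFun ν :=
  LinearMap.codRestrict (eqvFun ν) (LinearMap.pi fun x => (B w).comp (ρ x)) fun e =>
    ⟨hρ (B w) e, fun L hL x => by
      simp only [LinearMap.pi_apply, LinearMap.comp_apply, map_mul, Module.End.mul_apply]
      -- `Lᴴ` is upper triangular and acts on `w` by the conjugate scalar; conjugate-linearity of
      -- `B` undoes the conjugation.
      rw [hB L, hw Lᴴ fun i j hij => by rw [conjTranspose_apply, hL j i hij, star_zero],
        LinearMap.map_smulₛₗ, LinearMap.smul_apply, smul_eq_mul]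
      simp⟩

theorem coeffMap_apply {E : Type*} [AddCommGroup E] [Module ℂ E]
    {ρ : Representation ℂ (Matrix (Fin n) (Fin n) ℂ) E} (hρ : IsPolynomialRep ρ)
    {B : E →ₗ⋆[ℂ] E →ₗ[ℂ] ℂ} (hB : ∀ a v w, B w (ρ a v) = B (ρ aᴴ w) v) {ν : Fin n → ℕ} {w : E}
    (hw : IsHighest ρ ν w) (e : E) (x : Matrix (Fin n) (Fin n) ℂ) :
    (coeffMap hρ hB hw e).1 x = B w (ρ x e) := rfl

theorem coeffMap_rho {E : Type*} [AddCommGroup E] [Module ℂ E]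
    {ρ : Representation ℂ (Matrix (Fin n) (Fin n) ℂ) E} (hρ : IsPolynomialRep ρ)
    {B : E →ₗ⋆[ℂ] E →ₗ[ℂ] ℂ} (hB : ∀ a v w, B w (ρ a v) = B (ρ aᴴ w) v) {ν : Fin n → ℕ} {w : E}
    (hw : IsHighest ρ ν w) (a : Matrix (Fin n) (Fin n) ℂ) (e : E) :
    coeffMap hρ hB hw (ρ a e) = eqvRep ν a (coeffMap hρ hB hw e) := by
  ext x
  rw [eqvRep_apply, coeffMap_apply, coeffMap_apply, map_mul, Module.End.mul_apply]

/-- A polynomial representation whose highest weight spaces are lines, spanned by vectors `w p` of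
distinct highest weights `ν p`, is the direct sum of the corresponding irreducible ones. -/
theorem exists_equiv_pi_eqvFun {E : Type*} [AddCommGroup E] [Module ℂ E] [FiniteDimensional ℂ E]
    {ρ : Representation ℂ (Matrix (Fin n) (Fin n) ℂ) E} (hρ : IsPolynomialRep ρ)
    {I : Type*} [Fintype I] {ν : I → Fin n → ℕ} (hν : Function.Injective ν)
    {w : I → E} (hw0 : ∀ p, w p ≠ 0) (hw : ∀ p, IsHighest ρ (ν p) (w p))
    (huniq : ∀ μ v, v ≠ 0 → IsHighest ρ μ v → ∃ p, ∃ c : ℂ, v = c • w p) :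
    ∃ Φ : E ≃ₗ[ℂ] (∀ p, eqvFun (ν p)), ∀ a e p, Φ (ρ a e) p = eqvRep (ν p) a (Φ e p) := by
  classical
  obtain ⟨B, hBpos, hB⟩ := hρ.exists_invariant_form
  have hanti : ∀ p, Antitone (ν p) := fun p => hρ.antitone (hw p) (hw0 p)
  let Φ : E →ₗ[ℂ] (∀ p, eqvFun (ν p)) := LinearMap.pi fun p => coeffMap hρ hB (hw p)
  have hΦ : ∀ a e p, Φ (ρ a e) p = eqvRep (ν p) a (Φ e p) := fun a e p =>
    coeffMap_rho hρ hB (hw p) a e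
  have hΦw : ∀ p q, IsHighest (eqvRep (ν p)) (ν q) (Φ (w q) p) := fun p q b hb => by
    rw [← hΦ, hw q b hb, map_smul]
    rfl
  have hne : ∀ p, Φ (w p) p ≠ 0 := fun p h0 => by
    have h1 : (coeffMap hρ hB (hw p) (w p)).1 1 = 0 := congrArg (fun f : eqvFun (ν p) => f.1 1) h0
    rw [coeffMap_apply, map_one] at h1
    exact hBpos _ (hw0 p) h1
  have hoff : ∀ p q, p ≠ q → Φ (w q) p = 0 := fun p q hpq => by
    by_contra h0
    exact hpq (hν (eq_smul_eqvTop (hanti p) (hΦw p q) h0).1).symm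
  have hsingle : ∀ q, Φ (w q) = Pi.single q (Φ (w q) q) := fun q => by
    funext p
    by_cases hpq : p = q
    · subst hpq
      rw [Pi.single_eq_same]
    · rw [Pi.single_eq_of_ne hpq, hoff p q hpq]
  -- A nonzero kernel would contain a highest weight vector, hence some `w p`; but `Φ (w p) p` takes
  -- the value `B (w p) (w p) ≠ 0` at `1`.
  have hinj : LinearMap.ker Φ = ⊥ := by
    by_contra hker
    obtain ⟨μ, v, hv, hv0, hμ⟩ := hρ.exists_isHighest (W := LinearMap.ker Φ) (fun a v hv => by
      rw [LinearMap.mem_ker] at hv ⊢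
      funext p
      rw [hΦ, hv]
      simp) hker
    obtain ⟨p, c, rfl⟩ := huniq μ v hv0 hμ
    have hc : c ≠ 0 := fun hc => hv0 (by rw [hc, zero_smul])
    rw [LinearMap.mem_ker, map_smul] at hv
    exact hne p (congrFun ((smul_eq_zero.1 hv).resolve_left hc) p)
  have hsurj : LinearMap.range Φ = ⊤ := by
    -- As the weights are distinct, `Φ (w q)` is concentrated in the component `q`; the range
    -- therefore meets that irreducible component and contains it.
    have hcomp : ∀ q, (LinearMap.range Φ).comap (LinearMap.single ℂ (fun p => eqvFun (ν p)) q) = ⊤ :=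
      fun q => by
        refine eqvFun_irreducible (hanti q) (fun u f hf => ?_) fun h0 => hne q ?_
        · obtain ⟨e, he⟩ := hf
          refine ⟨ρ u e, ?_⟩
          funext p
          rw [hΦ, he]
          by_cases hpq : p = q
          · subst hpq
            simp
          · simp [Pi.single_eq_of_ne hpq]
        · rw [← Submodule.mem_bot ℂ, ← h0]
          exact ⟨w q, hsingle q⟩
    rw [eq_top_iff]
    intro F _
    rw [← LinearMap.sum_single_apply (fun p => eqvFun (ν p)) F]
    refine sum_mem fun q _ => ?_
    have : F q ∈ (LinearMap.range Φ).comap (LinearMap.single ℂ (fun p => eqvFun (ν p)) q) := by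
      rw [hcomp]
      trivial
    exact this
  exact ⟨LinearEquiv.ofBijective Φ ⟨LinearMap.ker_eq_bot.1 hinj, LinearMap.range_eq_top.1 hsurj⟩,
    hΦ⟩

theorem IsHighest.sub_smul {E : Type*} [AddCommGroup E] [Module ℂ E]
    {ρ : Representation ℂ (Matrix (Fin n) (Fin n) ℂ) E} {ν : Fin n → ℕ} {v w : E}
    (hv : IsHighest ρ ν v) (hw : IsHighest ρ ν w) (c : ℂ) : IsHighest ρ ν (v - c • w) :=
  fun b hb => by rw [map_sub, map_smul, hv b hb, hw b hb, smul_sub, smul_comm]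

theorem fourRowWeight_two (h : 4 ≤ n) (k i j : ℕ) :
    fourRowWeight n k i j (Fin.castLE h 2) = j := rfl

theorem fourRowWeight_three (h : 4 ≤ n) (k i j : ℕ) :
    fourRowWeight n k i j (Fin.castLE h 3) = i := rfl

theorem fourRowWeight_antitone {k i j : ℕ} (hij : i ≤ j) (hjk : j ≤ k) :
    Antitone (fourRowWeight n k i j) := by
  have hg : Antitone fun r : ℕ => [2 * k - i, 2 * k - j, j, i].getD r 0 := by
    refine antitone_nat_of_succ_le fun r => ?_
    rcases r with _ | _ | _ | _ | r
    all_goals simp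
    all_goals omega
  exact fun a b hab => hg hab

/-- The decomposition of the tensor square of `V_n(k, k, 0, …, 0)` over `SU(n)`. -/
theorem nonempty_tprod_equiv_directSum (h : 4 ≤ n) {k : ℕ} {lam₀ : Fin n → ℤ}
    (hlam₀ : ∀ r, lam₀ r = twoRow n k r + (0 : ℤ)) {I : Type} [Finite I] {i j : I → ℕ}
    (hij : ∀ p, i p ≤ j p) (hjk : ∀ p, j p ≤ k)
    (hinj : ∀ p q, i p = i q → j p = j q → p = q)
    (hsurj : ∀ a b, a ≤ b → b ≤ k → ∃ p, i p = a ∧ j p = b) {lam : I → Fin n → ℤ} {c : I → ℤ}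
    (hlam : ∀ p r, lam p r = fourRowWeight n k (i p) (j p) r + c p) :
    Nonempty (((repV lam₀).tprod (repV lam₀)).Equiv
      (Representation.directSum fun p => repV (lam p))) := by
  classical
  have := Fintype.ofFinite I
  choose w hw0 hw using fun p => exists_isHighest_fourRowWeight h (hij p) (hjk p)
  obtain ⟨Φ, hΦ⟩ := exists_equiv_pi_eqvFun
    ((isPolynomialRep_eqvRep (twoRow n k)).tprod (isPolynomialRep_eqvRep (twoRow n k)))
    (ν := fun p => fourRowWeight n k (i p) (j p)) (fun p q hpq => hinj p q
      (by
        have := congrFun hpq (Fin.castLE h 3)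
        simpa only [fourRowWeight_three] using this)
      (by
        have := congrFun hpq (Fin.castLE h 2)
        simpa only [fourRowWeight_two] using this)) hw0 hw fun μ v hv0 hv => by
      obtain ⟨a, b, hab, hbk, rfl⟩ := exists_eq_fourRowWeight h hv hv0
      obtain ⟨p, rfl, rfl⟩ := hsurj a b hab hbk
      have h0 : pairEval _ (w p) (1, basePoint h) ≠ 0 := fun h0 =>
        hw0 p (eq_zero_of_pairEval_basePoint h (hw p) h0)
      -- Chosen to make the difference vanish at `(1, basePoint h)`, so that it is zero.
      let c := pairEval _ v (1, basePoint h) / pairEval _ (w p) (1, basePoint h)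
      refine ⟨p, c, sub_eq_zero.1 (eq_zero_of_pairEval_basePoint h (hv.sub_smul (hw p) c) ?_)⟩
      refine (congrFun (LinearMap.map_sub (pairEval (twoRow n k)) v (c • w p)) _).trans ?_
      rw [Pi.sub_apply, LinearMap.map_smul, Pi.smul_apply, smul_eq_mul, div_mul_cancel₀ _ h0,
        sub_self]
  let Ψ₀ := equivSpaceV (twoRow_antitone n k) hlam₀
  let Ψ := fun p => equivSpaceV (fourRowWeight_antitone (hij p) (hjk p)) (hlam p)
  let e : (spaceV lam₀).toSubmodule ⊗[ℂ] (spaceV lam₀).toSubmodule ≃ₗ[ℂ]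
      ⨁ p, (spaceV (lam p)).toSubmodule :=
    ((TensorProduct.congr Ψ₀ Ψ₀).symm.trans Φ).trans
      ((LinearEquiv.piCongrRight Ψ).trans (DirectSum.linearEquivFunOnFintype ℂ I _).symm)
  have hΨ₀ : ∀ (g : SUGrp n) s, (repV lam₀).tprod (repV lam₀) g (TensorProduct.congr Ψ₀ Ψ₀ s) =
      TensorProduct.congr Ψ₀ Ψ₀
        ((eqvRep (twoRow n k)).tprod (eqvRep (twoRow n k)) g.1 s) := fun g s => by
    induction s using TensorProduct.induction_on with
    | zero => simp
    | add s t hs ht => rw [map_add, map_add, map_add, map_add, hs, ht]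
    | tmul f f' =>
      simp only [TensorProduct.congr_tmul, Representation.tprod_apply, TensorProduct.map_tmul]
      rw [repV_equivSpaceV, repV_equivSpaceV]
  have he : ∀ s p, e (TensorProduct.congr Ψ₀ Ψ₀ s) p = Ψ p (Φ s p) := fun s p => by
    change Ψ p (Φ ((TensorProduct.congr Ψ₀ Ψ₀).symm (TensorProduct.congr Ψ₀ Ψ₀ s)) p) = _
    rw [LinearEquiv.symm_apply_apply]
  refine ⟨Representation.Equiv.mk e fun g => LinearMap.ext fun t => ?_⟩
  obtain ⟨s, rfl⟩ := (TensorProduct.congr Ψ₀ Ψ₀).surjective t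
  refine DFinsupp.ext fun p => ?_
  change e ((repV lam₀).tprod (repV lam₀) g (TensorProduct.congr Ψ₀ Ψ₀ s)) p =
    repV (lam p) g (e (TensorProduct.congr Ψ₀ Ψ₀ s) p)
  rw [hΨ₀, he, he, hΦ, repV_equivSpaceV]

theorem fourRows_eq {k i j : ℕ} (hij : i ≤ j) (hjk : j ≤ k) (r : Fin n) :
    fourRows n (2 * k - i) (2 * k - j) j i r = fourRowWeight n k i j r + (0 : ℤ) := by
  rw [add_zero, fourRows, fourRowWeight]
  generalize (r : ℕ) = s
  rcases s with _ | _ | _ | _ | s <;> simp <;> omega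

theorem partitionOf_add (k l : Fin (n - 1) → ℕ) (r : Fin n) :
    partitionOf (k + l) r = partitionOf k r + partitionOf l r := by
  simp only [partitionOf, ← Finset.sum_add_distrib, Pi.add_apply]
  refine Finset.sum_congr rfl fun s _ => ?_
  split_ifs <;> simp

theorem partitionOf_smul (c : ℕ) (k : Fin (n - 1) → ℕ) (r : Fin n) :
    partitionOf (c • k) r = c * partitionOf k r := by
  simp only [partitionOf, Finset.mul_sum, Pi.smul_apply]
  refine Finset.sum_congr rfl fun s _ => ?_
  split_ifs <;> simp

theorem partitionOf_fundWeight {i : ℕ} (hi : 1 ≤ i) (r : Fin n) :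
    partitionOf (fundWeight n i) r = if (r : ℕ) < i ∧ i < n then 1 else 0 := by
  rw [partitionOf]
  by_cases hin : i < n
  · rw [Finset.sum_eq_single (⟨i - 1, by omega⟩ : Fin (n - 1))]
    · have h1 : ((r : ℕ) ≤ i - 1) ↔ (r : ℕ) < i := by omega
      simp [fundWeight, hin, h1, Nat.sub_add_cancel hi]
    · intro s _ hs
      have : (s : ℕ) + 1 ≠ i := fun hh => hs (Fin.ext (by simp only; omega))
      simp [fundWeight, this]
    · simp
  · rw [if_neg (fun hh => hin hh.2)]
    refine Finset.sum_eq_zero fun s _ => ?_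
    have : (s : ℕ) + 1 ≠ i := by omega
    simp [fundWeight, this]

theorem partitionOf_smul_fundWeight_two (h : 4 ≤ n) (k : ℕ) (r : Fin n) :
    partitionOf (k • fundWeight n 2) r = twoRow n k r + (0 : ℤ) := by
  have hn : 2 < n := by omega
  rw [partitionOf_smul, partitionOf_fundWeight (by norm_num), twoRow]
  split_ifs <;> simp_all

/-- For `n = 4` the weight `π_4` is zero, so the `i` columns of length four disappear and every
entry drops by `i`. The bound on `i + j` keeps the natural subtraction exact. -/
theorem partitionOf_eq (h : 4 ≤ n) {k i j : ℕ} (hijk : i + j ≤ k) (r : Fin n) :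
    partitionOf (j • fundWeight n 1 + (2 * k - 2 * i - 2 * j) • fundWeight n 2 +
      j • fundWeight n 3 + i • fundWeight n 4) r =
      fourRowWeight n k i (i + j) r + (if n = 4 then -(i : ℤ) else 0) := by
  have h1 : 1 < n := by omega
  have h2 : 2 < n := by omega
  have h3 : 3 < n := by omega
  have h4 : 4 < n ↔ n ≠ 4 := by omega
  have hr : n = 4 → (r : ℕ) < 4 := fun hn => hn ▸ r.isLt
  simp only [partitionOf_add, partitionOf_smul,
    partitionOf_fundWeight (n := n) (i := 1) (by norm_num),
    partitionOf_fundWeight (n := n) (i := 2) (by norm_num),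
    partitionOf_fundWeight (n := n) (i := 3) (by norm_num),
    partitionOf_fundWeight (n := n) (i := 4) (by norm_num), fourRowWeight, h1, h2, h3, h4, and_true]
  generalize (r : ℕ) = s at hr
  by_cases hn : n = 4
  · have hs := hr hn
    interval_cases s <;> simp [hn] <;> omega
  · rcases s with _ | _ | _ | _ | s <;> simp [hn] <;> omega

end Decomposition

end

/-! ### The three forms of the decomposition. -/

theorem mainTheorem5 (m k : ℕ) (hm : 2 ≤ m) :
    (∀ lam : Fin (m + 2) → ℤ, Antitone lam →
      IsIrrepOfHighestWeight (repVU lam) lam ∧ (repV lam).IsIrreducible) ∧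
    Nonempty (((repF (n := m + 2) (k • fundWeight (m + 2) 2)).tprod
        (repF (n := m + 2) (k • fundWeight (m + 2) 2))).Equiv
      (Representation.directSum fun p : {p : ℕ × ℕ // p.1 ≤ k ∧ p.1 ≤ p.2 ∧ p.2 ≤ k} =>
        repV (fourRows (m + 2) (2 * k - p.1.1) (2 * k - p.1.2) p.1.2 p.1.1))) ∧
    Nonempty (((repF (n := m + 2) (k • fundWeight (m + 2) 2)).tprod
        (repF (n := m + 2) (k • fundWeight (m + 2) 2))).Equiv
      (Representation.directSum fun p : {p : ℕ × ℕ // p.1 ≤ k ∧ p.2 ≤ k - p.1} =>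
        repV (fourRows (m + 2) (2 * k - p.1.1) (2 * k - p.1.1 - p.1.2) (p.1.1 + p.1.2) p.1.1))) ∧
    Nonempty (((repF (n := m + 2) (k • fundWeight (m + 2) 2)).tprod
        (repF (n := m + 2) (k • fundWeight (m + 2) 2))).Equiv
      (Representation.directSum fun p : {p : ℕ × ℕ // p.1 ≤ k ∧ p.2 ≤ k - p.1} =>
        repF (n := m + 2) (p.1.2 • fundWeight (m + 2) 1
          + (2 * k - 2 * p.1.1 - 2 * p.1.2) • fundWeight (m + 2) 2
          + p.1.2 • fundWeight (m + 2) 3 + p.1.1 • fundWeight (m + 2) 4))) := by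
  have h4 : 4 ≤ m + 2 := by omega
  have hfin1 : Finite {p : ℕ × ℕ // p.1 ≤ k ∧ p.1 ≤ p.2 ∧ p.2 ≤ k} :=
    Set.Finite.to_subtype (((Set.finite_Iic k).prod (Set.finite_Iic k)).subset
      fun p hp => ⟨hp.1, hp.2.2⟩)
  have hfin2 : Finite {p : ℕ × ℕ // p.1 ≤ k ∧ p.2 ≤ k - p.1} :=
    Set.Finite.to_subtype (((Set.finite_Iic k).prod (Set.finite_Iic k)).subset
      fun p hp => ⟨hp.1, hp.2.trans (Nat.sub_le _ _)⟩)
  refine ⟨fun lam hlam => ⟨isIrrepOfHighestWeight_repVU (by omega) hlam,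
    isIrreducible_repV (by omega) hlam⟩, ?_, ?_, ?_⟩
  · exact nonempty_tprod_equiv_directSum h4 (partitionOf_smul_fundWeight_two h4 k)
      (i := fun p => p.1.1) (j := fun p => p.1.2) (c := fun _ => 0)
      (fun p => p.2.2.1) (fun p => p.2.2.2) (fun p q h1 h2 => Subtype.ext (Prod.ext h1 h2))
      (fun a b hab hb => ⟨⟨(a, b), hab.trans hb, hab, hb⟩, rfl, rfl⟩)
      fun p r => fourRows_eq p.2.2.1 p.2.2.2 r
  · refine nonempty_tprod_equiv_directSum h4 (partitionOf_smul_fundWeight_two h4 k)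
      (i := fun p => p.1.1) (j := fun p => p.1.1 + p.1.2) (c := fun _ => 0)
      (fun p => Nat.le_add_right _ _) (fun p => by have := p.2; omega)
      (fun p q h1 h2 => Subtype.ext (Prod.ext h1 (by omega)))
      -- The second index is now the difference of the former two, whence `b - a`.
      (fun a b hab hb => ⟨⟨(a, b - a), hab.trans hb, Nat.sub_le_sub_right hb a⟩, rfl,
        Nat.add_sub_cancel' hab⟩) fun p r => ?_
    rw [← fourRows_eq (Nat.le_add_right _ _) (by have := p.2; omega)]
    congr 1
    push_cast
    ring
  · exact nonempty_tprod_equiv_directSum h4 (partitionOf_smul_fundWeight_two h4 k)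
      (i := fun p => p.1.1) (j := fun p => p.1.1 + p.1.2)
      -- The uniform shift for `m = 2` is a power of the determinant, trivial on `SU(4)`.
      (c := fun p => if m + 2 = 4 then -(p.1.1 : ℤ) else 0)
      (fun p => Nat.le_add_right _ _) (fun p => by have := p.2; omega)
      (fun p q h1 h2 => Subtype.ext (Prod.ext h1 (by omega)))
      (fun a b hab hb => ⟨⟨(a, b - a), hab.trans hb, Nat.sub_le_sub_right hb a⟩, rfl,
        Nat.add_sub_cancel' hab⟩)
      fun p r => partitionOf_eq h4 (by have := p.2; omega) r
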